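/- Let $M$ be a smooth finite-dimensional real manifold (without boundary, Hausdorff, paracompact) and let $E\to M$ be an $SU(n)$-vector bundle, $n\ge 1$: a smooth complex vector bundle of rank $n$ with a smooth hermitian structure and a given smooth trivialization of $\bigwedge^n E$ of unit length. An $SU(n)$-connection is a connection $\nabla^E$ on $E$ for which the hermitian structure and the trivialization of $\bigwedge^nE$ are parallel. Let $\mathfrak A=\Gamma(\mathrm{End}\,E)$ be the algebra of smooth sections of the bundle of complex linear endomorphisms of $E$, with the fiberwise trace $\mathrm{Tr}$ and the involution $S\mapsto S^*$ given by the hermitian structure. Let $\mathrm{Der}(\mathfrak A)$ be the space of its ($\mathbb C$-linear) derivations, and write $\mathrm{ad}_\gamma(S)=[\gamma,S]$. A derivation $\mathcal X$ is called real if $(\mathcal X S)^*=\mathcal X(S^*)$ for all $S\in\mathfrak A$. A noncommutative $1$-form on $\mathfrak A$ is a map $\mathrm{Der}(\mathfrak A)\to\mathfrak A$ that is linear over the center of $\mathfrak A$. Every $\mathcal X\in\mathrm{Der}(\mathfrak A)$ has an associated (complex) vector field $X$ on $M$, determined by $\mathcal X(f\,1)=(Xf)\,1$ for all smooth $f:M\to\mathbb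 C$. For a connection $\nabla^E$ on $E$, let $\nabla$ denote the induced connection on $\mathrm{End}(E)$, $(\nabla_XS)s=\nabla^E_X(Ss)-S(\nabla^E_Xs)$, where $\nabla^E_X$ is extended complex linearly in $X$. Then for each $SU(n)$-connection $\nabla^E$ on $E$ there is exactly one traceless noncommutative $1$-form $\alpha$ on $\mathfrak A$ such that $$\mathcal X=\nabla_X-\mathrm{ad}_{\alpha(\mathcal X)}\qquad\text{for all }\mathcal X\in\mathrm{Der}(\mathfrak A),$$ and the map $\nabla^E\mapsto\alpha$ is an isomorphism of (nonempty, real) affine spaces from the affine space of $SU(n)$-connections on $E$ onto the affine space of noncommutative $1$-forms $\alpha$ on $\mathfrak A$ that are traceless ($\mathrm{Tr}\,\alpha(\mathcal X)=0$ for all $\mathcal X\in\mathrm{Der}(\mathfrak A)$), antihermitian ($\alpha(\mathcal X)^*=-\alpha(\mathcal X)$ for all real $\mathcal X\in\mathrm{Der}(\mathfrak A)$) and satisfy $\alpha(\mathrm{ad}_\gamma)=-\gamma$ for all $\gamma\in\mathfrak A$ with $\mathrm{Tr}\,\gamma=0$. -/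

import Mathlib

open Bundle Manifold ContDiff

noncomputable section

namespace NCGauge

/-! ### Derivation-based noncommutative calculus of a complex algebra -/

section Algebra

variable (A : Type*) [Ring A] [Algebra ℂ A]

/-- `Der(A)`, the derivations of an associative unital complex algebra `A`, as a module over the
center of `A`. -/
def Der : Submodule (Subalgebra.center ℂ A) (A →ₗ[ℂ] A) where
  carrier := {D | ∀ a b : A, D (a * b) = D a * b + a * D b}
  add_mem' := by
    intro D D' hD hD' a b
    simp only [LinearMap.add_apply, hD a b, hD' a b, add_mul, mul_add]
    abel
  zero_mem' := by
    intro a b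
    simp
  smul_mem' := by
    intro z D hD a b
    have hz : (z : A) * a = a * z := (Subalgebra.mem_center_iff.mp z.2 a).symm
    simp only [LinearMap.smul_apply, hD a b, Subalgebra.smul_def, smul_eq_mul, mul_add]
    rw [← mul_assoc, ← mul_assoc, hz, mul_assoc a]

variable {A} in
/-- The inner derivation `ad_γ : a ↦ γ a - a γ`. -/
def ad (γ : A) : Der A :=
  ⟨LinearMap.mulLeft ℂ γ - LinearMap.mulRight ℂ γ, by
    intro a b
    simp only [LinearMap.sub_apply, LinearMap.mulLeft_apply, LinearMap.mulRight_apply]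
    noncomm_ring⟩

/-- Noncommutative `1`-forms on `A`: maps `Der(A) → A` that are linear over the center of `A`. -/
abbrev NCForm := Der A →ₗ[Subalgebra.center ℂ A] A

instance instAddCommGroupNCForm : AddCommGroup (NCForm A) := inferInstance

instance instModuleNCForm : Module ℂ (NCForm A) := inferInstance

instance instRealModuleNCForm : Module ℝ (NCForm A) := Module.complexToReal (NCForm A)

end Algebra

/-! ### Smooth sections of a complex vector bundle over a real manifold -/

section Bundle

variable {d : ℕ} {M : Type*} [TopologicalSpace M] [ChartedSpace (EuclideanSpace ℝ (Fin d)) M]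

section VectorFields

variable [IsManifold (𝓡 d) ∞ M]

variable (d M) in
/-- Smooth real vector fields on `M`. -/
abbrev VField := Cₛ^∞⟮𝓡 d; EuclideanSpace ℝ (Fin d), (TangentSpace (𝓡 d) : M → Type _)⟯

variable (d M) in
/-- `C^∞(M)`: smooth complex valued functions on `M`. -/
abbrev CFun := C^∞⟮𝓡 d, M; 𝓘(ℝ, ℂ), ℂ⟯

/-- The product `f X` of a smooth real function and a smooth vector field. -/
def smulField (f : C^∞⟮𝓡 d, M; 𝓘(ℝ, ℝ), ℝ⟯) (X : VField d M) : VField d M :=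
  ⟨fun x ↦ f x • X x, f.contMDiff.smul_section X.contMDiff⟩

/-- The derivative `X f` of a complex valued function `f` along the vector field `X`. -/
def lieD (X : VField d M) (f : M → ℂ) (x : M) : ℂ :=
  mfderiv (𝓡 d) 𝓘(ℝ, ℂ) f x (X x)

end VectorFields

variable {F : Type*} [NormedAddCommGroup F] [NormedSpace ℂ F]

/-- Multiplication by smooth complex functions preserves smoothness of sections of a complex
bundle. -/
theorem contMDiff_smul {V : M → Type*} [TopologicalSpace (TotalSpace F V)]
    [∀ x, AddCommGroup (V x)] [∀ x, Module ℂ (V x)] [∀ x, TopologicalSpace (V x)]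
    [FiberBundle F V] [VectorBundle ℂ F V]
    {f : M → ℂ} (hf : ContMDiff (𝓡 d) 𝓘(ℝ, ℂ) ∞ f) {s : ∀ x, V x}
    (hs : ContMDiff (𝓡 d) ((𝓡 d).prod 𝓘(ℝ, F)) ∞ fun x ↦ TotalSpace.mk' F x (s x)) :
    ContMDiff (𝓡 d) ((𝓡 d).prod 𝓘(ℝ, F)) ∞ fun x ↦ TotalSpace.mk' F x (f x • s x) := by
  intro x₀
  have h := (contMDiffAt_section x₀).1 (hs x₀)
  rw [contMDiffAt_section]
  have hb : ContDiff ℝ ∞ (fun p : ℂ × F ↦ p.1 • p.2) :=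
    (isBoundedBilinearMap_smul (𝕜 := ℝ) (A := ℂ) (E := F)).contDiff
  refine (hb.contMDiff.contMDiffAt.comp x₀ ((hf x₀).prodMk_space h)).congr_of_eventuallyEq ?_
  filter_upwards [(trivializationAt F V x₀).open_baseSet.mem_nhds
    (FiberBundle.mem_baseSet_trivializationAt' x₀)] with y hy
  exact ((trivializationAt F V x₀).linear ℂ hy).2 (f y) (s y)

variable {V : M → Type*} [TopologicalSpace (TotalSpace F V)]
  [∀ x, NormedAddCommGroup (V x)] [∀ x, InnerProductSpace ℂ (V x)]
  [FiberBundle F V] [VectorBundle ℂ F V]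

variable (d F V) in
/-- `Γ(E)`: smooth sections of `E`. -/
abbrev Sec := Cₛ^∞⟮𝓡 d; F, V⟯

/-- The product `f s` of a smooth complex function and a section. -/
def smulSec (f : CFun d M) (s : Sec d F V) : Sec d F V :=
  ⟨fun x ↦ f x • s x, contMDiff_smul f.contMDiff s.contMDiff⟩

variable (d F V) in
/-- The smooth sections of the bundle of complex linear endomorphisms of `E`, as a subalgebra of
the algebra of all sections with pointwise operations. -/
def endSubalgebra : Subalgebra ℂ (∀ x, V x →L[ℂ] V x) where
  carrier := {S | ContMDiff (𝓡 d) ((𝓡 d).prod 𝓘(ℝ, F →L[ℂ] F)) ∞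
    fun x ↦ TotalSpace.mk' (F →L[ℂ] F) (E := fun x ↦ V x →L[ℂ] V x) x (S x)}
  mul_mem' := by
    intro S T hS hT x₀
    have h := (contMDiffAt_section x₀).1 (hS x₀)
    have h' := (contMDiffAt_section x₀).1 (hT x₀)
    rw [contMDiffAt_section]
    have hb : ContDiff ℝ ∞ (fun p : (F →L[ℂ] F) × (F →L[ℂ] F) ↦ p.1 * p.2) := contDiff_mul
    refine (hb.contMDiff.contMDiffAt.comp x₀ (h.prodMk_space h')).congr_of_eventuallyEq ?_
    filter_upwards [(trivializationAt F V x₀).open_baseSet.mem_nhds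
      (FiberBundle.mem_baseSet_trivializationAt' x₀)] with y hy
    simp only [hom_trivializationAt_apply, Function.comp]
    rw [ContinuousLinearMap.inCoordinates_eq hy hy, ContinuousLinearMap.inCoordinates_eq hy hy,
      ContinuousLinearMap.inCoordinates_eq hy hy]
    ext v
    simp [Trivialization.symm_apply_apply_mk _ hy]
  add_mem' := by
    intro S T hS hT x₀
    have h := (contMDiffAt_section x₀).1 (hS x₀)
    have h' := (contMDiffAt_section x₀).1 (hT x₀)
    rw [contMDiffAt_section]
    refine (h.add h').congr_of_eventuallyEq ?_
    filter_upwards [(trivializationAt F V x₀).open_baseSet.mem_nhds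
      (FiberBundle.mem_baseSet_trivializationAt' x₀)] with y hy
    simp only [hom_trivializationAt_apply, Pi.add_apply]
    rw [ContinuousLinearMap.inCoordinates_eq hy hy, ContinuousLinearMap.inCoordinates_eq hy hy,
      ContinuousLinearMap.inCoordinates_eq hy hy]
    ext v
    simp
  algebraMap_mem' := by
    intro c x₀
    rw [contMDiffAt_section]
    refine (contMDiffAt_const (c := c • ContinuousLinearMap.id ℂ F)).congr_of_eventuallyEq ?_
    filter_upwards [(trivializationAt F V x₀).open_baseSet.mem_nhds
      (FiberBundle.mem_baseSet_trivializationAt' x₀)] with y hy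
    simp only [hom_trivializationAt_apply]
    rw [ContinuousLinearMap.inCoordinates_eq hy hy]
    ext v
    simp [Algebra.algebraMap_eq_smul_one, Trivialization.apply_mk_symm _ hy]

variable (d F V) in
/-- The algebra `𝔄 = Γ(End E)`. -/
def EndAlg : Type _ := ↥(endSubalgebra d F V)

instance instRingEndAlg : Ring (EndAlg d F V) := inferInstanceAs (Ring (endSubalgebra d F V))

instance instAlgebraEndAlg : Algebra ℂ (EndAlg d F V) :=
  inferInstanceAs (Algebra ℂ (endSubalgebra d F V))

/-- The central element `f 1 ∈ 𝔄` given by a smooth function `f`. -/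
def scalar (f : CFun d M) : EndAlg d F V :=
  ⟨fun x ↦ f x • ContinuousLinearMap.id ℂ (V x), by
    have h1 : (1 : ∀ x, V x →L[ℂ] V x) ∈ endSubalgebra d F V := one_mem _
    exact contMDiff_smul f.contMDiff h1⟩

/-- The section `S s : x ↦ S(x) s(x)`. -/
def act (S : EndAlg d F V) (s : Sec d F V) : Sec d F V :=
  ⟨fun x ↦ S.1 x (s x), by
    intro x₀
    have h := (contMDiffAt_section x₀).1 (S.2 x₀)
    have h' := (contMDiffAt_section x₀).1 (s.contMDiff x₀)
    rw [contMDiffAt_section]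
    have hb : ContDiff ℝ ∞ (fun p : (F →L[ℂ] F) × F ↦ p.1 p.2) :=
      (ContinuousLinearMap.apply ℂ F).flip.isBoundedBilinearMap.contDiff.restrict_scalars ℝ
    refine (hb.contMDiff.contMDiffAt.comp x₀ (h.prodMk_space h')).congr_of_eventuallyEq ?_
    filter_upwards [(trivializationAt F V x₀).open_baseSet.mem_nhds
      (FiberBundle.mem_baseSet_trivializationAt' x₀)] with y hy
    simp only [hom_trivializationAt_apply, Function.comp]
    rw [ContinuousLinearMap.inCoordinates_eq hy hy]
    simp [Trivialization.symm_apply_apply_mk _ hy]⟩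

/-- `T = S^*` in `𝔄`, with respect to the hermitian structure. -/
def IsAdj (S T : EndAlg d F V) : Prop :=
  ∀ x (v w : V x), inner ℂ (S.1 x v) w = inner ℂ v (T.1 x w)

/-- The trace of an element of `𝔄` at a point. -/
def tr (S : EndAlg d F V) (x : M) : ℂ := LinearMap.trace ℂ (V x) (S.1 x : V x →ₗ[ℂ] V x)

/-- A derivation `𝒳` of `𝔄` is real if `(𝒳 S)^* = 𝒳 (S^*)` for all `S`. -/
def IsReal (D : Der (EndAlg d F V)) : Prop :=
  ∀ S T : EndAlg d F V, IsAdj S T → IsAdj (D.1 S) (D.1 T)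

variable (d F V) in
/-- The affine space of noncommutative `1`-forms `α` on `𝔄` that are traceless, antihermitian
(`α(𝒳)^* = - α(𝒳)` for every real derivation `𝒳`) and satisfy `α(ad_γ) = - γ` for every traceless
`γ ∈ 𝔄`. It is an affine subspace of the space of all noncommutative `1`-forms on `𝔄`. -/
def gaugeForms : AffineSubspace ℝ (NCForm (EndAlg d F V)) where
  carrier := {α | (∀ D x, tr (α D) x = 0) ∧
    (∀ D, IsReal D → IsAdj (α D) (-α D)) ∧
    (∀ γ : EndAlg d F V, (∀ x, tr γ x = 0) → α (ad γ) = -γ)}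
  smul_vsub_vadd_mem' := by
    rintro c α β δ ⟨h1, h2, h3⟩ ⟨k1, k2, k3⟩ ⟨l1, l2, l3⟩
    have key : ∀ D x, ((c • (α - β) + δ : NCForm (EndAlg d F V)) D).1 x =
        (c : ℂ) • ((α D).1 x - (β D).1 x) + (δ D).1 x := fun _ _ ↦ rfl
    have keyn : ∀ (S : EndAlg d F V) x, (-S).1 x = -(S.1 x) := fun _ _ ↦ rfl
    refine ⟨fun D x ↦ ?_, fun D hD x v w ↦ ?_, fun γ hγ ↦ ?_⟩
    · have a1 := h1 D x
      have a2 := k1 D x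
      have a3 := l1 D x
      simp only [tr] at a1 a2 a3 ⊢
      rw [vsub_eq_sub, vadd_eq_add, key]
      simp [a1, a2, a3]
    · have a1 := h2 D hD x v w
      have a2 := k2 D hD x v w
      have a3 := l2 D hD x v w
      rw [keyn] at a1 a2 a3 ⊢
      rw [vsub_eq_sub, vadd_eq_add, key]
      simp only [_root_.add_apply, _root_.sub_apply,
        _root_.smul_apply, _root_.neg_apply, inner_add_left,
        inner_add_right, inner_sub_left, inner_sub_right, inner_smul_left, inner_smul_right,
        inner_neg_right, Complex.conj_ofReal] at a1 a2 a3 ⊢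
      linear_combination (c : ℂ) * (a1 - a2) + a3
    · rw [vsub_eq_sub, vadd_eq_add]
      have a1 := h3 γ hγ
      have a2 := k3 γ hγ
      have a3 := l3 γ hγ
      apply Subtype.ext
      funext x
      rw [key, a1, a2, a3]
      simp

section Connections

variable [IsManifold (𝓡 d) ∞ M] [VectorBundle ℝ F V]

variable (d F V) in
/-- An `SU(n)`-structure on `E`: the hermitian structure of the fibers is smooth, and `Λⁿ E` is
trivialized by a smooth section `vol` of its dual which has length one, so that the orthonormal
frames with `vol = 1` are the `SU(n)`-frames of `E`. -/
structure SUStructure (n : ℕ) where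
  /-- the hermitian structure is smooth -/
  smooth_inner : ∀ s t : Sec d F V,
    ContMDiff (𝓡 d) 𝓘(ℝ, ℂ) ∞ fun x ↦ (inner ℂ (s x) (t x) : ℂ)
  /-- the trivialization of `Λⁿ E` -/
  vol : ∀ x, V x [⋀^Fin n]→ₗ[ℂ] ℂ
  smooth_vol : ∀ s : Fin n → Sec d F V,
    ContMDiff (𝓡 d) 𝓘(ℝ, ℂ) ∞ fun x ↦ vol x fun i ↦ s i x
  norm_vol : ∀ x (e : OrthonormalBasis (Fin n) ℂ (V x)), ‖vol x e‖ = 1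

/-- `∇` is a connection (covariant derivative) `Γ(TM) × Γ(E) → Γ(E)` on the complex vector
bundle `E`. -/
structure IsConnection (cov : VField d M → Sec d F V → Sec d F V) : Prop where
  add_field : ∀ X Y s, cov (X + Y) s = cov X s + cov Y s
  smul_field : ∀ (f : C^∞⟮𝓡 d, M; 𝓘(ℝ, ℝ), ℝ⟯) X s x, cov (smulField f X) s x = f x • cov X s x
  add_sec : ∀ X s t, cov X (s + t) = cov X s + cov X t
  leibniz : ∀ X (f : CFun d M) s x,
    cov X (smulSec f s) x = lieD X f x • s x + f x • cov X s x

/-- `∇` is an `SU(n)`-connection: a connection for which the hermitian structure and the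
trivialization of `Λⁿ E` are parallel. -/
structure IsSUConnection {n : ℕ} (σ : SUStructure d F V n)
    (cov : VField d M → Sec d F V → Sec d F V) : Prop extends IsConnection cov where
  metric : ∀ X s t x, lieD X (fun y ↦ (inner ℂ (s y) (t y) : ℂ)) x =
    inner ℂ (cov X s x) (t x) + inner ℂ (s x) (cov X t x)
  volume : ∀ X (s : Fin n → Sec d F V) x, lieD X (fun y ↦ σ.vol y fun i ↦ s i y) x =
    ∑ i, σ.vol x (Function.update (fun j ↦ s j x) i (cov X (s i) x))

/-- The affine space of `SU(n)`-connections on `E`, an affine subspace of the space of all maps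
`Γ(TM) × Γ(E) → Γ(E)`. -/
def suConnections {n : ℕ} (σ : SUStructure d F V n) :
    AffineSubspace ℝ (VField d M → Sec d F V → Sec d F V) where
  carrier := {cov | IsSUConnection σ cov}
  smul_vsub_vadd_mem' := by
    intro c p q r hp hq hr
    have key : ∀ X s x, (c • (p - q) + r) X s x = c • (p X s x - q X s x) + r X s x :=
      fun _ _ _ ↦ rfl
    have kadd : ∀ (s t : Sec d F V) x, (s + t) x = s x + t x := fun _ _ _ ↦ rfl
    rw [vsub_eq_sub, vadd_eq_add]
    refine ⟨⟨fun X Y s ↦ ?_, fun f X s x ↦ ?_, fun X s t ↦ ?_, fun X f s x ↦ ?_⟩,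
      fun X s t x ↦ ?_, fun X s x ↦ ?_⟩
    · ext x
      simp only [kadd, key, hp.add_field, hq.add_field,
        hr.add_field]
      module
    · simp only [key, hp.smul_field, hq.smul_field, hr.smul_field]
      module
    · ext x
      simp only [kadd, key, hp.add_sec, hq.add_sec,
        hr.add_sec]
      module
    · simp only [key, hp.leibniz, hq.leibniz, hr.leibniz]
      rw [add_sub_add_left_eq_sub, ← smul_sub, smul_comm, smul_add]
      abel
    · have a1 := hp.metric X s t x
      have a2 := hq.metric X s t x
      have a3 := hr.metric X s t x
      have kc : ∀ u : V x, c • u = (c : ℂ) • u := fun _ ↦ rfl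
      simp only [key, kc, inner_add_left, inner_add_right, inner_sub_left, inner_sub_right,
        inner_smul_left, inner_smul_right, Complex.conj_ofReal]
      linear_combination a3 + (c : ℂ) * (a1 - a2)
    · have a1 := hp.volume X s x
      have a2 := hq.volume X s x
      have a3 := hr.volume X s x
      have kc : ∀ u : V x, c • u = (c : ℂ) • u := fun _ ↦ rfl
      simp only [key, kc, AlternatingMap.map_update_add, AlternatingMap.map_update_smul,
        AlternatingMap.map_update_sub, Finset.sum_add_distrib, ← Finset.smul_sum,
        Finset.sum_sub_distrib, ← a1, ← a2, ← a3]
      simp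

variable (d M) in
/-- Complex vector fields `X = X₁ + i X₂` on `M`, that is, sections of `ℂ ⊗ TM`. These are the
vector fields that occur as derivations of the algebra of complex valued functions. -/
structure CVField where
  /-- real part -/
  re : VField d M
  /-- imaginary part -/
  im : VField d M

/-- The derivative `X f = X₁ f + i X₂ f`. -/
def CVField.lie (X : CVField d M) (f : M → ℂ) (x : M) : ℂ :=
  lieD X.re f x + Complex.I * lieD X.im f x

/-- The complex linear extension `∇_X s = ∇_{X₁} s + i ∇_{X₂} s` to complex vector fields. -/
def covC (cov : VField d M → Sec d F V → Sec d F V) (X : CVField d M) (s : Sec d F V) (x : M) :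
    V x :=
  cov X.re s x + Complex.I • cov X.im s x

/-- The connection on `End E` induced by `∇`, described by its action on sections of `E`:
`(∇_X S) s = ∇_X (S s) - S (∇_X s)`. -/
def endCov (cov : VField d M → Sec d F V → Sec d F V) (X : CVField d M) (S : EndAlg d F V)
    (s : Sec d F V) (x : M) : V x :=
  covC cov X (act S s) x - S.1 x (covC cov X s x)

/-- `X` is the vector field of the derivation `𝒳` of `𝔄`: the restriction of `𝒳` to the functions
`f 1` is `f ↦ X f`. -/
def IsFieldOf (D : Der (EndAlg d F V)) (X : CVField d M) : Prop :=
  ∀ (f : CFun d M) x, (D.1 (scalar f)).1 x = X.lie f x • ContinuousLinearMap.id ℂ (V x)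

/-- `α` is a noncommutative `1`-form of the connection `∇`: every derivation `𝒳` of `𝔄`, with
vector field `X`, decomposes as `𝒳 = ∇_X - ad_{α(𝒳)}`. -/
def IsFormOf (cov : VField d M → Sec d F V → Sec d F V) (α : NCForm (EndAlg d F V)) : Prop :=
  ∀ D : Der (EndAlg d F V), ∃ X : CVField d M, IsFieldOf D X ∧
    ∀ (S : EndAlg d F V) (s : Sec d F V) x,
      (D.1 S).1 x (s x) = endCov cov X S s x - ((ad (α D)).1 S).1 x (s x)

end Connections

end Bundle

end NCGauge

end

/-! The center of `𝔄` is the algebra of smooth functions, so a derivation `𝒳` restricts to a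
derivation of functions, that is, to a complex vector field `X` (`exists_isFieldOf`, via Hadamard's
lemma). Then `𝒳 - ∇_X` kills functions, hence is a derivation linear over functions. At each point
it is a derivation of a full matrix algebra, so it is inner, and its traceless generator is unique;
uniqueness glues the local generators to a smooth section (`exists_inner`). This gives `𝒳 = ∇_X -
ad_a` with exactly one traceless `a`, and uniqueness again makes `𝒳 ↦ a` linear over the center
(`connForm`).

The conditions on `α` reflect those on `∇`. If `𝒳` is real, so are `X` and, by metricity, `∇_X`;
hence `a + a^*` commutes with `𝔄`, and being traceless it vanishes
(`IsSUConnection.isAdj_connForm`). The inner derivation `ad_γ` has field `0`, which forces `α(ad_γ)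
= -γ` for traceless `γ`.

Injectivity: if two connections have the same form, they agree on `End E`, so their difference is
central in `𝔄`; it is traceless because both preserve the volume
(`IsSUConnection.eq_of_connForm_eq`). Surjectivity: given `α` and a reference connection `∇`, the
connection `∇_Y + α(∇_Y)` is an `SU(n)`-connection with form `α` (`isFormOf_addForm`). The
correspondence is affine because the defining equation is (`isFormOf_affine`). A reference
connection exists by patching connections with parallel orthonormal frames (`exists_frame`,
`exists_isSUConnection`). -/

noncomputable section

set_option linter.unusedSectionVars false

namespace NCGauge

variable {d n : ℕ} {M : Type*} [TopologicalSpace M] [ChartedSpace (EuclideanSpace ℝ (Fin d)) M]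
  {F : Type*} [NormedAddCommGroup F] [NormedSpace ℂ F]
  {V : M → Type*} [TopologicalSpace (TotalSpace F V)]
  [∀ x, NormedAddCommGroup (V x)] [∀ x, InnerProductSpace ℂ (V x)]
  [FiberBundle F V] [VectorBundle ℂ F V]

/-! ### Cutoffs and local orthonormal frames of volume one -/

open Topology Set in
/-- Smooth cutoff functions. -/
theorem exists_cutoff [IsManifold (𝓡 d) ∞ M] [T2Space M] {x₀ : M} {U : Set M} (hU : U ∈ 𝓝 x₀) :
    ∃ χ : C^∞⟮𝓡 d, M; 𝓘(ℝ, ℝ), ℝ⟯, (χ : M → ℝ) =ᶠ[𝓝 x₀] 1 ∧ tsupport χ ⊆ U ∧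
      HasCompactSupport χ ∧ ∀ x, 0 ≤ χ x := by
  obtain ⟨f, -, hf⟩ := (SmoothBumpFunction.nhds_basis_tsupport (I := 𝓡 d) x₀).mem_iff.1 hU
  exact ⟨⟨f, f.contMDiff⟩, f.eventuallyEq_one, hf, f.hasCompactSupport, fun _ ↦ f.nonneg⟩

/-- Smoothness of a section at a point. -/
abbrev SmoothSecAt (d : ℕ) {M : Type*} [TopologicalSpace M]
    [ChartedSpace (EuclideanSpace ℝ (Fin d)) M] (F : Type*) [NormedAddCommGroup F] [NormedSpace ℂ F]
    {V : M → Type*} [TopologicalSpace (TotalSpace F V)]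
    [∀ x, TopologicalSpace (V x)] [FiberBundle F V] (s : ∀ x, V x) (x : M) : Prop :=
  ContMDiffAt (𝓡 d) ((𝓡 d).prod 𝓘(ℝ, F)) ∞ (fun x ↦ TotalSpace.mk' F x (s x)) x

theorem SmoothSecAt.smul {f : M → ℂ} {x₀ : M} (hf : ContMDiffAt (𝓡 d) 𝓘(ℝ, ℂ) ∞ f x₀)
    {s : ∀ x, V x} (hs : SmoothSecAt d F s x₀) : SmoothSecAt d F (fun x ↦ f x • s x) x₀ := by
  have h := (contMDiffAt_section x₀).1 hs
  rw [SmoothSecAt, contMDiffAt_section]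
  have hb : ContDiff ℝ ∞ (fun p : ℂ × F ↦ p.1 • p.2) :=
    (isBoundedBilinearMap_smul (𝕜 := ℝ) (A := ℂ) (E := F)).contDiff
  refine (hb.contMDiff.contMDiffAt.comp x₀ (hf.prodMk_space h)).congr_of_eventuallyEq ?_
  filter_upwards [(trivializationAt F V x₀).open_baseSet.mem_nhds
    (FiberBundle.mem_baseSet_trivializationAt' x₀)] with y hy
  exact ((trivializationAt F V x₀).linear ℂ hy).2 (f y) (s y)

theorem contMDiffAt_mul {f g : M → ℂ} {x : M} (hf : ContMDiffAt (𝓡 d) 𝓘(ℝ, ℂ) ∞ f x)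
    (hg : ContMDiffAt (𝓡 d) 𝓘(ℝ, ℂ) ∞ g x) :
    ContMDiffAt (𝓡 d) 𝓘(ℝ, ℂ) ∞ (fun x ↦ f x * g x) x := by
  have hb : ContDiff ℝ ∞ (fun p : ℂ × ℂ ↦ p.1 * p.2) := contDiff_mul
  exact hb.contMDiff.contMDiffAt.comp x (hf.prodMk_space hg)

section Local

variable [IsManifold (𝓡 d) ∞ M] [T2Space M] [VectorBundle ℝ F V]

open Topology Set in
/-- A smooth section near a point extends to a global section. -/
theorem exists_extend {ι : Type*} {U : Set M} (hU : IsOpen U) {x₀ : M} (hx₀ : x₀ ∈ U)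
    {s : ι → ∀ x, V x} (hs : ∀ i, ∀ x ∈ U, SmoothSecAt d F (s i) x) :
    ∃ t : ι → Sec d F V, ∀ᶠ y in 𝓝 x₀, ∀ i, t i y = s i y := by
  -- One cutoff serves the whole family, so a single neighbourhood works for all `i`.
  obtain ⟨χ, h1, h2, -⟩ := exists_cutoff (d := d) (hU.mem_nhds hx₀)
  refine ⟨fun i ↦ ⟨(χ : M → ℝ) • s i, ContMDiffOn.smul_section_of_tsupport
    χ.contMDiff.contMDiffOn hU h2 fun x hx ↦ (hs i x hx).contMDiffWithinAt⟩, ?_⟩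
  filter_upwards [h1] with y hy i
  change χ y • s i y = s i y
  rw [hy]; simp

-- `smooth_inner` speaks of global sections only; since smoothness is local, `exists_extend` carries
-- it over to sections over an open set.
open Topology Set in
theorem contMDiffAt_inner (σ : SUStructure d F V n) {U : Set M} (hU : IsOpen U)
    {s t : ∀ x, V x} (hs : ∀ x ∈ U, SmoothSecAt d F s x) (ht : ∀ x ∈ U, SmoothSecAt d F t x)
    {x : M} (hx : x ∈ U) :
    ContMDiffAt (𝓡 d) 𝓘(ℝ, ℂ) ∞ (fun x ↦ (inner ℂ (s x) (t x) : ℂ)) x := by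
  obtain ⟨s', h's⟩ := exists_extend (ι := Unit) hU hx (s := fun _ ↦ s) fun _ ↦ hs
  obtain ⟨t', h't⟩ := exists_extend (ι := Unit) hU hx (s := fun _ ↦ t) fun _ ↦ ht
  refine (σ.smooth_inner (s' ()) (t' ()) x).congr_of_eventuallyEq ?_
  filter_upwards [h's, h't] with y h1 h2
  rw [h1, h2]

open Topology Set in
theorem contMDiffAt_vol (σ : SUStructure d F V n) {U : Set M} (hU : IsOpen U)
    {s : Fin n → ∀ x, V x} (hs : ∀ i, ∀ x ∈ U, SmoothSecAt d F (s i) x) {x : M} (hx : x ∈ U) :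
    ContMDiffAt (𝓡 d) 𝓘(ℝ, ℂ) ∞ (fun x ↦ σ.vol x fun i ↦ s i x) x := by
  obtain ⟨s', h's⟩ := exists_extend hU hx hs
  refine (σ.smooth_vol s' x).congr_of_eventuallyEq ?_
  filter_upwards [h's] with y h1
  simp_rw [h1]

-- Strong induction: each Gram–Schmidt vector is `s i` minus a combination of earlier ones, whose
-- coefficients have nonvanishing denominators by linear independence.
open InnerProductSpace in
theorem smoothSecAt_gramSchmidt (σ : SUStructure d F V n) {m : ℕ} {U : Set M} (hU : IsOpen U)
    {s : Fin m → ∀ x, V x} (hs : ∀ i, ∀ x ∈ U, SmoothSecAt d F (s i) x)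
    (hli : ∀ x ∈ U, LinearIndependent ℂ fun i ↦ s i x) (i : Fin m) :
    ∀ x ∈ U, SmoothSecAt d F (fun x ↦ gramSchmidt ℂ (fun i ↦ s i x) i) x := by
  induction i using WellFoundedLT.induction with
  | ind i ih =>
  intro x hx
  -- The squared norms are written as complex inner products so that `contMDiffAt_inner` applies to
  -- them.
  have key : ∀ x, gramSchmidt ℂ (fun i ↦ s i x) i = s i x - ∑ j ∈ Finset.Iio i,
      ((inner ℂ (gramSchmidt ℂ (fun i ↦ s i x) j) (s i x) : ℂ) *
        (inner ℂ (gramSchmidt ℂ (fun i ↦ s i x) j) (gramSchmidt ℂ (fun i ↦ s i x) j) : ℂ)⁻¹) •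
          gramSchmidt ℂ (fun i ↦ s i x) j := by
    intro x
    conv_rhs => rw [gramSchmidt_def'' ℂ (fun i ↦ s i x) i]
    rw [eq_sub_iff_add_eq]
    congr 1
    refine Finset.sum_congr rfl fun j _ ↦ ?_
    rw [inner_self_eq_norm_sq_to_K, ← div_eq_mul_inv]
    conv_rhs => rw [gramSchmidt_def'' ℂ (fun i ↦ s i x) i]
  simp_rw [SmoothSecAt, key]
  refine (hs i x hx).sub_section (ContMDiffAt.sum_section fun j hj ↦ ?_)
  have hj' := ih j (Finset.mem_Iio.1 hj)
  refine SmoothSecAt.smul (contMDiffAt_mul (contMDiffAt_inner σ hU hj' (hs i) hx) ?_) (hj' x hx)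
  have h0 : (inner ℂ (gramSchmidt ℂ (fun i ↦ s i x) j)
      (gramSchmidt ℂ (fun i ↦ s i x) j) : ℂ) ≠ 0 :=
    inner_self_ne_zero.2 (gramSchmidt_ne_zero j (hli x hx))
  have hinv : ContDiffAt ℝ ∞ (fun z : ℂ ↦ z⁻¹) (inner ℂ (gramSchmidt ℂ (fun i ↦ s i x) j)
      (gramSchmidt ℂ (fun i ↦ s i x) j) : ℂ) := contDiffAt_inv ℝ h0
  exact hinv.contMDiffAt.comp x (contMDiffAt_inner σ hU hj' hj' hx)

/-- The sections `t` form an orthonormal frame of volume one at `x`. -/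
structure IsFrameAt (σ : SUStructure d F V n) (t : Fin n → Sec d F V) (x : M) : Prop where
  orthonormal : Orthonormal ℂ fun i ↦ t i x
  vol_eq : σ.vol x (fun i ↦ t i x) = 1

theorem finrank_fiber (hF : Module.finrank ℂ F = n) (x : M) : Module.finrank ℂ (V x) = n := by
  rw [← hF]
  exact ((trivializationAt F V x).continuousLinearEquivAt ℂ x
    (FiberBundle.mem_baseSet_trivializationAt' x)).toLinearEquiv.finrank_eq

theorem finiteDimensional_fiber [FiniteDimensional ℂ F] (x : M) : FiniteDimensional ℂ (V x) :=
  ((trivializationAt F V x).continuousLinearEquivAt ℂ x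
    (FiberBundle.mem_baseSet_trivializationAt' x)).symm.toLinearEquiv.finiteDimensional

-- Gram–Schmidt turns the frame of a trivialization into an orthonormal one, whose volume has
-- modulus one by `norm_vol`. Correcting the phase of the first vector makes the volume equal to
-- one.
open Topology Set InnerProductSpace in
theorem exists_frame (hn : 0 < n) [FiniteDimensional ℂ F] (hF : Module.finrank ℂ F = n)
    [ContMDiffVectorBundle ∞ F V (𝓡 d)] (σ : SUStructure d F V n) (x₀ : M) :
    ∃ t : Fin n → Sec d F V, ∀ᶠ y in 𝓝 x₀, IsFrameAt σ t y := by
  set e := trivializationAt F V x₀ with he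
  have hU := e.open_baseSet
  have hx₀ : x₀ ∈ e.baseSet := FiberBundle.mem_baseSet_trivializationAt' x₀
  let b : Module.Basis (Fin n) ℂ F := Module.finBasisOfFinrankEq ℂ F hF
  let s : Fin n → ∀ x, V x := fun i x ↦ e.symm x (b i)
  have hs : ∀ i, ∀ x ∈ e.baseSet, SmoothSecAt d F (s i) x := by
    intro i x hx
    rw [SmoothSecAt, e.contMDiffAt_section_iff hx]
    refine (contMDiffAt_const (c := b i)).congr_of_eventuallyEq ?_
    filter_upwards [hU.mem_nhds hx] with y hy
    simp [s, e.apply_mk_symm hy]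
  have hli : ∀ x ∈ e.baseSet, LinearIndependent ℂ fun i ↦ s i x := by
    intro x hx
    have := b.linearIndependent.map' (e.linearEquivAt ℂ x hx).symm.toLinearMap
      (LinearEquiv.ker _)
    exact this
  let g : Fin n → ∀ x, V x := fun i x ↦ gramSchmidtNormed ℂ (fun i ↦ s i x) i
  have hg : ∀ i, ∀ x ∈ e.baseSet, SmoothSecAt d F (g i) x := by
    intro i x hx
    have h1 := smoothSecAt_gramSchmidt σ hU hs hli i
    refine SmoothSecAt.smul ?_ (h1 x hx)
    have hsq : ∀ y, (inner ℂ (gramSchmidt ℂ (fun i ↦ s i y) i)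
        (gramSchmidt ℂ (fun i ↦ s i y) i) : ℂ) =
        ((‖gramSchmidt ℂ (fun i ↦ s i y) i‖ ^ 2 : ℝ) : ℂ) := fun y ↦ by
      rw [inner_self_eq_norm_sq_to_K]; norm_cast
    have hpos : (inner ℂ (gramSchmidt ℂ (fun i ↦ s i x) i)
        (gramSchmidt ℂ (fun i ↦ s i x) i) : ℂ).re ≠ 0 := by
      rw [hsq, Complex.ofReal_re]
      exact pow_ne_zero 2 (norm_ne_zero_iff.2 (gramSchmidt_ne_zero i (hli x hx)))
    -- The normalizing factor is the inverse norm, a smooth function of the squared norm away from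
    -- zero.
    have hinv : ContDiffAt ℝ ∞ (fun z : ℂ ↦ ((Real.sqrt z.re : ℝ) : ℂ)⁻¹)
        (inner ℂ (gramSchmidt ℂ (fun i ↦ s i x) i) (gramSchmidt ℂ (fun i ↦ s i x) i) : ℂ) := by
      refine ContDiffAt.inv (Complex.ofRealCLM.contDiff.contDiffAt.comp _
        ((Complex.reCLM.contDiff.contDiffAt).sqrt hpos)) ?_
      norm_cast
      rw [Real.sqrt_eq_zero']
      simp only [not_le]
      refine lt_of_le_of_ne ?_ hpos.symm
      exact inner_self_nonneg (𝕜 := ℂ)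
    refine (hinv.contMDiffAt.comp x (contMDiffAt_inner σ hU h1 h1 hx)).congr_of_eventuallyEq
      (Filter.Eventually.of_forall fun y ↦ ?_)
    simp only [Function.comp]
    rw [hsq, Complex.ofReal_re, Real.sqrt_sq (norm_nonneg _)]
    rfl
  have hon : ∀ x ∈ e.baseSet, Orthonormal ℂ fun i ↦ g i x := fun x hx ↦
    gramSchmidtNormed_orthonormal (hli x hx)
  have hvol : ∀ x ∈ e.baseSet, ‖σ.vol x fun i ↦ g i x‖ = 1 := by
    intro x hx
    have := finiteDimensional_fiber (F := F) (V := V) x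
    have hsp := (hon x hx).linearIndependent.span_eq_top_of_card_eq_finrank' (by
      simp [finrank_fiber hF])
    have := σ.norm_vol x (OrthonormalBasis.mk (hon x hx) hsp.ge)
    simpa using this
  have : NeZero n := ⟨hn.ne'⟩
  -- The conjugate of the volume is its inverse, since it has modulus one.
  let c : M → ℂ := fun x ↦ star (σ.vol x fun i ↦ g i x)
  have hc : ∀ x ∈ e.baseSet, ContMDiffAt (𝓡 d) 𝓘(ℝ, ℂ) ∞ c x := fun x hx ↦
    (Complex.conjCLE.contDiff (n := ∞)).contMDiff.contMDiffAt.comp x (contMDiffAt_vol σ hU hg hx)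
  let f : Fin n → ∀ x, V x := fun i x ↦ (if i = 0 then c x else 1) • g i x
  have hf : ∀ i, ∀ x ∈ e.baseSet, SmoothSecAt d F (f i) x := by
    intro i x hx
    refine SmoothSecAt.smul ?_ (hg i x hx)
    split_ifs
    · exact hc x hx
    · exact contMDiffAt_const
  obtain ⟨t, ht⟩ := exists_extend hU hx₀ hf
  refine ⟨t, ?_⟩
  filter_upwards [ht, hU.mem_nhds hx₀] with y hy hyU
  have h1 : ∀ i, ‖(if i = (0 : Fin n) then c y else 1)‖ = 1 := by
    intro i
    split_ifs
    · simpa [c] using hvol y hyU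
    · simp
  refine ⟨?_, ?_⟩
  · simp_rw [hy, f]
    refine ⟨fun i ↦ by rw [norm_smul, h1, (hon y hyU).1 i, one_mul], fun i j hij ↦ ?_⟩
    simp only [inner_smul_left, inner_smul_right, (hon y hyU).2 hij, mul_zero]
  · simp_rw [hy, f]
    have := (σ.vol y).toMultilinearMap.map_smul_univ
      (fun i ↦ if i = (0 : Fin n) then c y else 1) (fun i ↦ g i y)
    rw [AlternatingMap.coe_multilinearMap] at this
    rw [this, Finset.prod_ite_eq' , if_pos (Finset.mem_univ _)]
    have h2 := hvol y hyU
    simp only [c, smul_eq_mul]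
    rw [Complex.star_def, Complex.conj_mul', h2]; simp

end Local

/-! ### Hadamard's lemma in a vector space -/

section Hadamard

open MeasureTheory Set Topology

/-- Differentiation under the integral sign, by induction on the order. The derivative is an
integral of the same kind with values in `E →L[ℝ] W`, so the induction has to generalize `W`. -/
theorem contDiff_intervalIntegral_of_contDiff {E : Type} [NormedAddCommGroup E] [NormedSpace ℝ E]
    [FiniteDimensional ℝ E] (m : ℕ) {W : Type} [NormedAddCommGroup W] [NormedSpace ℝ W]
    [CompleteSpace W] {K : E × ℝ → W} (hK : ContDiff ℝ m K) :
    ContDiff ℝ m fun z ↦ ∫ t in (0 : ℝ)..1, K (z, t) := by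
  induction m generalizing W with
  | zero =>
    simp only [CharP.cast_eq_zero, contDiff_zero] at hK ⊢
    exact intervalIntegral.continuous_parametric_intervalIntegral_of_continuous'
      (f := fun z t ↦ K (z, t)) hK 0 1
  | succ m ih =>
    have h1 : Differentiable ℝ K := hK.differentiable (by simp)
    let K' : E × ℝ → E →L[ℝ] W := fun p ↦ (fderiv ℝ K p).comp (ContinuousLinearMap.inl ℝ E ℝ)
    have hK' : ContDiff ℝ m K' :=
      (hK.fderiv_right (m := m) (by norm_cast)).clm_comp contDiff_const
    have hd : ∀ z t, HasFDerivAt (fun z ↦ K (z, t)) (K' (z, t)) z := fun z t ↦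
      (h1 (z, t)).hasFDerivAt.comp z (hasFDerivAt_prodMk_left z t)
    -- The dominating constant is a bound of `K'` on the product of a closed unit ball with `[0,
    -- 1]`, compact because `E` is finite-dimensional.
    refine (contDiff_succ_iff_hasFDerivAt (n := m)).2
      ⟨fun z ↦ ∫ t in (0 : ℝ)..1, K' (z, t), ih hK', fun z ↦ ?_⟩
    obtain ⟨C, hC⟩ := ((isCompact_closedBall z 1).prod (isCompact_uIcc (a := (0 : ℝ))
      (b := 1))).exists_bound_of_continuousOn hK'.continuous.continuousOn
    refine intervalIntegral.hasFDerivAt_integral_of_dominated_of_fderiv_le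
      (F := fun z t ↦ K (z, t)) (F' := fun z t ↦ K' (z, t)) (bound := fun _ ↦ C)
      (Metric.closedBall_mem_nhds z one_pos)
      (Filter.Eventually.of_forall fun y ↦ ?_) ?_ ?_ ?_ ?_ ?_
    · exact (hK.continuous.comp (by fun_prop)).aestronglyMeasurable
    · exact (hK.continuous.comp (by fun_prop)).intervalIntegrable _ _
    · exact (hK'.continuous.comp (by fun_prop)).aestronglyMeasurable
    · exact Filter.Eventually.of_forall fun t ht y hy ↦ hC (y, t) ⟨hy, uIoc_subset_uIcc ht⟩
    · exact intervalIntegrable_const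
    · exact Filter.Eventually.of_forall fun t _ y _ ↦ hd y t

/-- Hadamard's lemma. -/
theorem exists_hadamard {E : Type} [NormedAddCommGroup E] [NormedSpace ℝ E]
    [FiniteDimensional ℝ E] {H : E → ℂ} (hH : ContDiff ℝ ∞ H) (z₀ : E) :
    ∃ G : E → E →L[ℝ] ℂ, ContDiff ℝ ∞ G ∧ ∀ z, H z - H z₀ = G z (z - z₀) := by
  have hK : ContDiff ℝ ∞ fun p : E × ℝ ↦ fderiv ℝ H (z₀ + p.2 • (p.1 - z₀)) :=
    (hH.fderiv_right (m := ∞) (by simp)).comp (by fun_prop)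
  -- `G z` averages the derivative of `H` over the segment from `z₀` to `z`; the identity is the
  -- fundamental theorem of calculus along it.
  refine ⟨fun z ↦ ∫ t in (0 : ℝ)..1, fderiv ℝ H (z₀ + t • (z - z₀)),
    contDiff_infty.2 fun m ↦ contDiff_intervalIntegral_of_contDiff m
      (K := fun p : E × ℝ ↦ fderiv ℝ H (z₀ + p.2 • (p.1 - z₀)))
      (hK.of_le (by exact_mod_cast le_top)), fun z ↦ ?_⟩
  have hc : Continuous fun t : ℝ ↦ fderiv ℝ H (z₀ + t • (z - z₀)) :=
    hK.continuous.comp (g := fun p : E × ℝ ↦ fderiv ℝ H (z₀ + p.2 • (p.1 - z₀)))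
      (f := fun t : ℝ ↦ (z, t)) (by fun_prop)
  have hd : ∀ t : ℝ, HasDerivAt (fun t : ℝ ↦ H (z₀ + t • (z - z₀)))
      (fderiv ℝ H (z₀ + t • (z - z₀)) (z - z₀)) t := fun t ↦ by
    have h1 : HasDerivAt (fun t : ℝ ↦ z₀ + t • (z - z₀)) (z - z₀) t := by
      simpa using ((hasDerivAt_id t).smul_const (z - z₀)).const_add z₀
    exact ((hH.differentiable (by simp)) _).hasFDerivAt.comp_hasDerivAt t h1
  have := intervalIntegral.integral_eq_sub_of_hasDerivAt (a := 0) (b := 1)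
    (fun t _ ↦ hd t) ((hc.clm_apply continuous_const).intervalIntegrable _ _)
  simp only [one_smul, zero_smul, add_zero, add_sub_cancel] at this
  rw [← this, ContinuousLinearMap.intervalIntegral_apply (hc.intervalIntegrable _ _)]

end Hadamard

instance instContMDiffRingComplex : ContMDiffRing 𝓘(ℝ, ℂ) ∞ ℂ where
  contMDiff_mul := by
    have h : ContDiff ℝ ∞ fun p : ℂ × ℂ ↦ p.1 * p.2 := contDiff_mul
    exact h.contMDiff.comp (contMDiff_fst.prodMk_space contMDiff_snd)

/-- Constant functions. -/
def constFun (c : ℂ) : CFun d M := ⟨fun _ ↦ c, contMDiff_const⟩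

/-- Smooth real valued functions as complex valued functions. -/
def ofRealFun (f : C^∞⟮𝓡 d, M; 𝓘(ℝ, ℝ), ℝ⟯) : CFun d M :=
  ⟨fun x ↦ (f x : ℂ), (Complex.ofRealCLM.contDiff (n := ∞)).contMDiff.comp f.contMDiff⟩

/-- The complex conjugate of a smooth function. -/
def conjFun (f : CFun d M) : CFun d M :=
  ⟨fun x ↦ star (f x), (Complex.conjCLE.contDiff (n := ∞)).contMDiff.comp f.contMDiff⟩

@[simp] theorem constFun_apply (c : ℂ) (x : M) : (constFun c : CFun d M) x = c := rfl

@[simp] theorem ofRealFun_apply (f : C^∞⟮𝓡 d, M; 𝓘(ℝ, ℝ), ℝ⟯) (x : M) :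
    ofRealFun f x = (f x : ℂ) := rfl

@[simp] theorem conjFun_apply (f : CFun d M) (x : M) : conjFun f x = star (f x) := rfl

/-! ### Coordinates and Hadamard's lemma on the manifold -/

section Manifold

variable [IsManifold (𝓡 d) ∞ M] [T2Space M]

open Topology Set

/-- Multiplication by a cutoff function extends a locally defined smooth function. -/
theorem exists_cutoff_mul {W : Type*} [NormedAddCommGroup W] [NormedSpace ℝ W] {U : Set M}
    (hU : IsOpen U) (χ : C^∞⟮𝓡 d, M; 𝓘(ℝ, ℝ), ℝ⟯) (hχ : tsupport χ ⊆ U)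
    {f : M → W} (hf : ContMDiffOn (𝓡 d) 𝓘(ℝ, W) ∞ f U) :
    ContMDiff (𝓡 d) 𝓘(ℝ, W) ∞ fun x ↦ χ x • f x := by
  refine contMDiff_of_tsupport fun x hx ↦ ?_
  have hxU := hχ (tsupport_smul_subset_left _ _ hx)
  exact χ.contMDiff.contMDiffAt.smul (hf.contMDiffAt (hU.mem_nhds hxU))

variable (d) in
/-- Global functions which agree near `x₀` with the coordinates centered at `x₀`. -/
theorem exists_coord (x₀ : M) : ∃ κ : Fin d → C^∞⟮𝓡 d, M; 𝓘(ℝ, ℝ), ℝ⟯, ∀ᶠ y in 𝓝 x₀,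
    ∀ i, κ i y = (extChartAt (𝓡 d) x₀ y : EuclideanSpace ℝ (Fin d)) i -
      (extChartAt (𝓡 d) x₀ x₀ : EuclideanSpace ℝ (Fin d)) i := by
  obtain ⟨χ, h1, h2, -⟩ := exists_cutoff (d := d) (chart_source_mem_nhds (EuclideanSpace ℝ (Fin d)) x₀)
  have hs : ∀ i, ContMDiffOn (𝓡 d) 𝓘(ℝ, ℝ) ∞ (fun y ↦
      (extChartAt (𝓡 d) x₀ y : EuclideanSpace ℝ (Fin d)) i -
      (extChartAt (𝓡 d) x₀ x₀ : EuclideanSpace ℝ (Fin d)) i)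
      (chartAt (EuclideanSpace ℝ (Fin d)) x₀).source := fun i ↦ by
    have : ContDiff ℝ ∞ fun z : EuclideanSpace ℝ (Fin d) ↦ z i -
      (extChartAt (𝓡 d) x₀ x₀ : EuclideanSpace ℝ (Fin d)) i := by fun_prop
    exact this.contMDiff.comp_contMDiffOn contMDiffOn_extChartAt
  refine ⟨fun i ↦ ⟨_, exists_cutoff_mul (chartAt _ x₀).open_source χ h2 (hs i)⟩, ?_⟩
  filter_upwards [h1] with y hy i
  change χ y • ((_ : ℝ) - _) = _
  rw [hy]; simp

variable (d) in
/-- Coordinate functions centered at `x₀`, cut off away from `x₀`. -/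
def coord (x₀ : M) : Fin d → C^∞⟮𝓡 d, M; 𝓘(ℝ, ℝ), ℝ⟯ := (exists_coord d x₀).choose

theorem coord_eventually (x₀ : M) : ∀ᶠ y in 𝓝 x₀, ∀ i, coord d x₀ i y =
    (extChartAt (𝓡 d) x₀ y : EuclideanSpace ℝ (Fin d)) i -
      (extChartAt (𝓡 d) x₀ x₀ : EuclideanSpace ℝ (Fin d)) i := (exists_coord d x₀).choose_spec

theorem coord_self (x₀ : M) (i : Fin d) : coord d x₀ i x₀ = 0 := by
  rw [(coord_eventually x₀).self_of_nhds i, sub_self]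

/-- Hadamard's lemma in a chart; the factor `χ` turns the local expansion into an identity of global
functions, to which a derivation can be applied. -/
theorem exists_hadamard_coord (f : CFun d M) (x₀ : M) : ∃ (χ : CFun d M) (g : Fin d → CFun d M),
    χ x₀ = 1 ∧ ∀ y, χ y * (f y - f x₀) = ∑ i, g i y * (coord d x₀ i y : ℂ) := by
  set φ := extChartAt (𝓡 d) x₀ with hφ
  obtain ⟨b, hb1, hb2, hb3, -⟩ := exists_cutoff (d := d) (extChartAt_source_mem_nhds (I := 𝓡 d) x₀)
  have hsrc : IsOpen φ.source := isOpen_extChartAt_source x₀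
  have htgt : IsOpen φ.target := isOpen_extChartAt_target x₀
  -- `b f` in the chart, extended by zero. It is smooth on the whole space because the image of the
  -- compact support of `b` is closed; so the shape of the chart's image does not matter.
  let H : EuclideanSpace ℝ (Fin d) → ℂ := φ.target.indicator fun z ↦ b (φ.symm z) • f (φ.symm z)
  have hHc : IsClosed (φ '' tsupport b) :=
    (hb3.isCompact.image_of_continuousOn ((continuousOn_extChartAt x₀).mono hb2)).isClosed
  have hH : ContDiff ℝ ∞ H := by
    rw [contDiff_iff_contDiffAt]
    intro z
    by_cases hz : z ∈ φ.target
    · have h1 : ContMDiffAt 𝓘(ℝ, EuclideanSpace ℝ (Fin d)) 𝓘(ℝ, ℂ) ∞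
          (fun z ↦ b (φ.symm z) • f (φ.symm z)) z := by
        have hs : ContMDiffAt 𝓘(ℝ, EuclideanSpace ℝ (Fin d)) (𝓡 d) ∞ φ.symm z :=
          (contMDiffOn_extChartAt_symm x₀).contMDiffAt (htgt.mem_nhds hz)
        exact (b.contMDiff.contMDiffAt.comp z hs).smul (f.contMDiff.contMDiffAt.comp z hs)
      refine (h1.contDiffAt).congr_of_eventuallyEq ?_
      filter_upwards [htgt.mem_nhds hz] with w hw
      exact indicator_of_mem hw _
    · have hz' : z ∈ (φ '' tsupport b)ᶜ := by
        rintro ⟨y, hy, rfl⟩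
        exact hz (φ.map_source (hb2 hy))
      refine (contDiffAt_const (c := (0 : ℂ))).congr_of_eventuallyEq ?_
      filter_upwards [hHc.isOpen_compl.mem_nhds hz'] with w hw
      by_cases hwt : w ∈ φ.target
      · refine (indicator_of_mem hwt _).trans ?_
        have : b (φ.symm w) = 0 := by
          by_contra h0
          exact hw ⟨φ.symm w, subset_tsupport _ h0, φ.right_inv hwt⟩
        simp only [this, zero_smul]
      · exact indicator_of_notMem hwt _
  obtain ⟨G, hG, hGH⟩ := exists_hadamard hH (φ x₀)
  have hev : ∀ᶠ y in 𝓝 x₀, f y - f x₀ = ∑ i, G (φ y) (EuclideanSpace.single i 1) *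
      (coord d x₀ i y : ℂ) := by
    filter_upwards [coord_eventually (d := d) x₀, hb1, hsrc.mem_nhds (mem_extChartAt_source x₀)]
      with y h1 h2 h3
    have e : ∀ y ∈ φ.source, b y = 1 → H (φ y) = f y := fun y hy hby ↦ by
      simp only [H]
      rw [indicator_of_mem (φ.map_source hy), φ.left_inv hy, hby, one_smul]
    rw [← e y h3 h2, ← e x₀ (mem_extChartAt_source x₀) hb1.self_of_nhds, hGH]
    have hsum : φ y - φ x₀ = ∑ i, (coord d x₀ i y) • EuclideanSpace.single i (1 : ℝ) := by
      ext j
      simp [h1, Finset.sum_apply, Pi.single_apply, hφ]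
    conv_lhs => rw [hsum]
    simp only [map_sum, map_smul]
    exact Finset.sum_congr rfl fun i _ ↦ by rw [Complex.real_smul, mul_comm]
  -- `χ` lives where the local expansion holds and the chart is defined; elsewhere both sides
  -- vanish, as each `g i` contains the factor `χ`.
  obtain ⟨χ, hc1, hc2, -⟩ := exists_cutoff (d := d)
    (Filter.inter_mem hev (extChartAt_source_mem_nhds (I := 𝓡 d) x₀))
  have hg : ∀ i, ContMDiffOn (𝓡 d) 𝓘(ℝ, ℂ) ∞ (fun y ↦ G (φ y) (EuclideanSpace.single i 1))
      φ.source := fun i ↦ by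
    have : ContDiff ℝ ∞ fun z ↦ G z (EuclideanSpace.single i 1) := hG.clm_apply contDiff_const
    refine this.contMDiff.comp_contMDiffOn ?_
    rw [hφ, extChartAt_source]
    exact contMDiffOn_extChartAt
  refine ⟨ofRealFun χ, fun i ↦ ⟨_, exists_cutoff_mul hsrc χ (hc2.trans inter_subset_right) (hg i)⟩,
    by simp [hc1.self_of_nhds], fun y ↦ ?_⟩
  change (χ y : ℂ) * _ = ∑ i, (χ y • _) * _
  by_cases hy : χ y = 0
  · simp [hy]
  · have : f y - f x₀ = _ := (hc2 (subset_tsupport _ hy)).1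
    rw [this, Finset.mul_sum]
    exact Finset.sum_congr rfl fun i _ ↦ by rw [Complex.real_smul, mul_assoc]

end Manifold

/-! ### Point derivations and complex vector fields -/

section Fields

variable [IsManifold (𝓡 d) ∞ M]

/-- `δ` is a derivation at the point `x` of the algebra of smooth functions. -/
structure IsPointDer (x : M) (δ : CFun d M → ℂ) : Prop where
  add : ∀ f g, δ (f + g) = δ f + δ g
  mul : ∀ f g, δ (f * g) = δ f * g x + f x * δ g
  const : ∀ c, δ (constFun c) = 0

/-- The derivative of a function in the direction of a tangent vector. -/
def ptD {x : M} (v : TangentSpace (𝓡 d) x) (f : M → ℂ) : ℂ := mfderiv (𝓡 d) 𝓘(ℝ, ℂ) f x v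

theorem lieD_eq (X : VField d M) (f : M → ℂ) (x : M) : lieD X f x = ptD (X x) f := rfl

theorem mdiffAt {W : Type*} [NormedAddCommGroup W] [NormedSpace ℝ W] {f : M → W}
    (hf : ContMDiff (𝓡 d) 𝓘(ℝ, W) ∞ f) (x : M) : MDifferentiableAt (𝓡 d) 𝓘(ℝ, W) f x :=
  hf.mdifferentiable (by simp) x

theorem ptD_congr {x : M} (v : TangentSpace (𝓡 d) x) {f g : M → ℂ}
    (h : f =ᶠ[nhds x] g) : ptD v f = ptD v g := by
  unfold ptD
  have := h.mfderiv_eq (I := 𝓡 d) (I' := 𝓘(ℝ, ℂ))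
  exact congrArg (fun L : TangentSpace (𝓡 d) x →L[ℝ] ℂ ↦ L v) this

theorem ptD_comp {W : Type*} [NormedAddCommGroup W] [NormedSpace ℝ W] {x : M}
    (v : TangentSpace (𝓡 d) x) {f : M → W} (hf : MDifferentiableAt (𝓡 d) 𝓘(ℝ, W) f x)
    (L : W →L[ℝ] ℂ) : ptD v (fun y ↦ L (f y)) = L (mfderiv (𝓡 d) 𝓘(ℝ, W) f x v) := by
  have := (L.hasMFDerivAt (x := f x)).comp x hf.hasMFDerivAt
  exact congrArg (fun L : TangentSpace (𝓡 d) x →L[ℝ] ℂ ↦ L v) this.mfderiv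

theorem ptD_add {x : M} (v : TangentSpace (𝓡 d) x) {f g : M → ℂ}
    (hf : MDifferentiableAt (𝓡 d) 𝓘(ℝ, ℂ) f x) (hg : MDifferentiableAt (𝓡 d) 𝓘(ℝ, ℂ) g x) :
    ptD v (fun y ↦ f y + g y) = ptD v f + ptD v g :=
  congrArg (fun L : TangentSpace (𝓡 d) x →L[ℝ] ℂ ↦ L v)
    (hf.hasMFDerivAt.add hg.hasMFDerivAt).mfderiv

theorem ptD_mul {x : M} (v : TangentSpace (𝓡 d) x) {f g : M → ℂ}
    (hf : MDifferentiableAt (𝓡 d) 𝓘(ℝ, ℂ) f x) (hg : MDifferentiableAt (𝓡 d) 𝓘(ℝ, ℂ) g x) :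
    ptD v (fun y ↦ f y * g y) = ptD v f * g x + f x * ptD v g := by
  have : ptD v (fun y ↦ f y * g y) = f x * ptD v g + g x * ptD v f :=
    congrArg (fun L : TangentSpace (𝓡 d) x →L[ℝ] ℂ ↦ L v)
      (hf.hasMFDerivAt.mul hg.hasMFDerivAt).mfderiv
  rw [this]; ring

theorem ptD_const {x : M} (v : TangentSpace (𝓡 d) x) (c : ℂ) : ptD v (fun _ ↦ c) = 0 :=
  congrArg (fun L : TangentSpace (𝓡 d) x →L[ℝ] ℂ ↦ L v)
    (hasMFDerivAt_const (I := 𝓡 d) (I' := 𝓘(ℝ, ℂ)) c x).mfderiv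

theorem ptD_sum {x : M} (v : TangentSpace (𝓡 d) x) {ι : Type*} (s : Finset ι) {f : ι → M → ℂ}
    (hf : ∀ i, MDifferentiableAt (𝓡 d) 𝓘(ℝ, ℂ) (f i) x) :
    MDifferentiableAt (𝓡 d) 𝓘(ℝ, ℂ) (fun y ↦ ∑ i ∈ s, f i y) x ∧
      ptD v (fun y ↦ ∑ i ∈ s, f i y) = ∑ i ∈ s, ptD v (f i) := by
  classical
  induction s using Finset.induction_on with
  | empty => simpa using! ⟨mdifferentiableAt_const, ptD_const v 0⟩
  | insert a s ha ih =>
    simp only [Finset.sum_insert ha]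
    exact ⟨(hf a).add ih.1, by rw [ptD_add v (hf a) ih.1, ih.2]⟩

theorem ptD_star {x : M} (v : TangentSpace (𝓡 d) x) {f : M → ℂ}
    (hf : MDifferentiableAt (𝓡 d) 𝓘(ℝ, ℂ) f x) :
    ptD v (fun y ↦ star (f y)) = star (ptD v f) :=
  ptD_comp v hf (Complex.conjCLE : ℂ →L[ℝ] ℂ)

theorem ptD_add_vec {x : M} (v w : TangentSpace (𝓡 d) x) (f : M → ℂ) :
    ptD (v + w) f = ptD v f + ptD w f := map_add (mfderiv (𝓡 d) 𝓘(ℝ, ℂ) f x) v w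

theorem ptD_smul_vec {x : M} (c : ℝ) (v : TangentSpace (𝓡 d) x) (f : M → ℂ) :
    ptD (c • v) f = c * ptD v f := by
  have : ptD (c • v) f = c • ptD v f := map_smul (mfderiv (𝓡 d) 𝓘(ℝ, ℂ) f x) c v
  rw [this, Complex.real_smul]

theorem ptD_ofReal_im {x : M} (v : TangentSpace (𝓡 d) x) {f : M → ℝ}
    (hf : MDifferentiableAt (𝓡 d) 𝓘(ℝ, ℝ) f x) : (ptD v (fun y ↦ (f y : ℂ))).im = 0 := by
  have := ptD_comp v hf Complex.ofRealCLM
  simp only [Complex.ofRealCLM_apply] at this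
  rw [this]
  exact Complex.ofReal_im _

theorem isPointDer_ptD {x : M} (v w : TangentSpace (𝓡 d) x) :
    IsPointDer x fun f : CFun d M ↦ ptD v f + Complex.I * ptD w f where
  add f g := by
    have h := fun v : TangentSpace (𝓡 d) x ↦ ptD_add v (mdiffAt f.contMDiff x) (mdiffAt g.contMDiff x)
    simp only [ContMDiffMap.coe_add]
    simp only [Pi.add_def, h]
    ring
  mul f g := by
    have h := fun v : TangentSpace (𝓡 d) x ↦ ptD_mul v (mdiffAt f.contMDiff x) (mdiffAt g.contMDiff x)
    simp only [ContMDiffMap.coe_mul]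
    simp only [Pi.mul_def, h]
    ring
  const c := by
    have h := fun v : TangentSpace (𝓡 d) x ↦ ptD_const v c
    change ptD v (fun _ ↦ c) + Complex.I * ptD w (fun _ ↦ c) = 0
    simp [h]

variable [T2Space M]

/-- Applied to the expansion of `exists_hadamard_coord`, where `χ x = 1` and the coordinates vanish
at `x`, the product rule leaves `δ f = ∑ g i x * δ (coord i)`. -/
theorem IsPointDer.ext {x : M} {δ ε : CFun d M → ℂ} (hδ : IsPointDer x δ) (hε : IsPointDer x ε)
    (h : ∀ i, δ (ofRealFun (coord d x i)) = ε (ofRealFun (coord d x i))) (f : CFun d M) :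
    δ f = ε f := by
  obtain ⟨χ, g, h1, h2⟩ := exists_hadamard_coord f x
  have key : ∀ {δ : CFun d M → ℂ}, IsPointDer x δ →
      δ f = ∑ i, g i x * δ (ofRealFun (coord d x i)) := by
    intro δ hδ
    have h3 : χ * (f + constFun (-f x)) = ∑ i, g i * ofRealFun (coord d x i) := by
      ext y
      rw [← ContMDiffMap.coeFnAddMonoidHom_apply (∑ i, g i * ofRealFun (coord d x i)), map_sum]
      simpa [sub_eq_add_neg] using h2 y
    let D : CFun d M →+ ℂ := AddMonoidHom.mk' δ hδ.add
    have h4 : δ (χ * (f + constFun (-f x))) = δ f := by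
      rw [hδ.mul, hδ.add, hδ.const, h1]; simp
    rw [← h4, h3]
    refine (map_sum D _ _).trans (Finset.sum_congr rfl fun i _ ↦ ?_)
    refine (hδ.mul _ _).trans ?_
    rw [ofRealFun_apply, coord_self]; simp
  rw [key hδ, key hε]
  exact Finset.sum_congr rfl fun i _ ↦ by rw [h]

variable (d) in
/-- The components of a vector. -/
abbrev component (i : Fin d) : EuclideanSpace ℝ (Fin d) →L[ℝ] ℝ := EuclideanSpace.proj i

/-- The coordinates stay centered at `x₀` while `y` varies, which is what smoothness of the
components of a field near `x₀` requires. -/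
theorem eventually_ptD_coord (x₀ : M) : ∀ᶠ y in nhds x₀, ∀ (v : TangentSpace (𝓡 d) y) i,
    ptD v (fun z ↦ (coord d x₀ i z : ℂ)) =
      (component d i
        (mfderiv (𝓡 d) 𝓘(ℝ, EuclideanSpace ℝ (Fin d)) (extChartAt (𝓡 d) x₀) y v) : ℂ) := by
  filter_upwards [eventually_eventually_nhds.2 (coord_eventually (d := d) x₀),
    (chartAt (EuclideanSpace ℝ (Fin d)) x₀).open_source.mem_nhds (mem_chart_source _ x₀)]
    with y hy hys v i
  have hm : MDifferentiableAt (𝓡 d) 𝓘(ℝ, EuclideanSpace ℝ (Fin d)) (extChartAt (𝓡 d) x₀) y :=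
    mdifferentiableAt_extChartAt hys
  let L : EuclideanSpace ℝ (Fin d) →L[ℝ] ℂ :=
    Complex.ofRealCLM.comp (component d i)
  have h1 : (fun z ↦ (coord d x₀ i z : ℂ)) =ᶠ[nhds y] fun z ↦ L (extChartAt (𝓡 d) x₀ z) +
      (-L (extChartAt (𝓡 d) x₀ x₀)) := by
    filter_upwards [hy] with z hz
    rw [hz i]
    simp [L, sub_eq_add_neg]
  have hL : MDifferentiableAt (𝓡 d) 𝓘(ℝ, ℂ) (fun z ↦ L (extChartAt (𝓡 d) x₀ z)) y :=
    L.mdifferentiableAt.comp y hm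
  refine ((ptD_congr v h1).trans (ptD_add v hL mdifferentiableAt_const)).trans ?_
  rw [ptD_const, add_zero]
  exact ptD_comp v hm L

theorem ptD_coord {x : M} (v : TangentSpace (𝓡 d) x) (i : Fin d) :
    ptD v (fun z ↦ (coord d x i z : ℂ)) = (component d i v : ℂ) := by
  rw [(eventually_ptD_coord x).self_of_nhds v i, mfderiv_extChartAt_self]
  rfl

theorem CVField.ext_lie {X Y : CVField d M} (h : ∀ (f : CFun d M) x, X.lie f x = Y.lie f x) :
    X = Y := by
  have key : ∀ x (i : Fin d), (component d i (X.re x) : ℂ) +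
      Complex.I * (component d i (X.im x) : ℂ) =
      (component d i (Y.re x) : ℂ) +
      Complex.I * (component d i (Y.im x) : ℂ) := fun x i ↦ by
    have := h (ofRealFun (coord d x i)) x
    simp only [CVField.lie, lieD_eq] at this
    simpa only [← ptD_coord] using! this
  obtain ⟨X₁, X₂⟩ := X
  obtain ⟨Y₁, Y₂⟩ := Y
  congr 1
  · refine ContMDiffSection.ext fun x ↦ PiLp.ext fun i ↦ ?_
    simpa using congrArg Complex.re (key x i)
  · refine ContMDiffSection.ext fun x ↦ PiLp.ext fun i ↦ ?_
    simpa using congrArg Complex.im (key x i)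

/-- In the trivialization at `x₀` the components of `R` are its derivatives of the coordinate
functions, smooth by hypothesis. -/
theorem smooth_field {R : ∀ x : M, TangentSpace (𝓡 d) x}
    (hR : ∀ f : C^∞⟮𝓡 d, M; 𝓘(ℝ, ℝ), ℝ⟯, ContMDiff (𝓡 d) 𝓘(ℝ, ℂ) ∞ fun x ↦
      ptD (R x) fun y ↦ (f y : ℂ)) :
    ContMDiff (𝓡 d) ((𝓡 d).prod 𝓘(ℝ, EuclideanSpace ℝ (Fin d))) ∞
      fun x ↦ TotalSpace.mk' (EuclideanSpace ℝ (Fin d)) x (R x) := by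
  intro x₀
  rw [contMDiffAt_section]
  have h1 : ContMDiffAt (𝓡 d) 𝓘(ℝ, EuclideanSpace ℝ (Fin d)) ∞ (fun y ↦
      (EuclideanSpace.equiv (Fin d) ℝ).symm fun i ↦
        (ptD (R y) fun z ↦ (coord d x₀ i z : ℂ)).re) x₀ := by
    refine (EuclideanSpace.equiv (Fin d) ℝ).symm.contDiff.contMDiff.contMDiffAt.comp x₀ ?_
    rw [contMDiffAt_pi_space]
    exact fun i ↦ Complex.reCLM.contDiff.contMDiff.contMDiffAt.comp x₀ (hR _ x₀)
  refine h1.congr_of_eventuallyEq ?_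
  filter_upwards [eventually_ptD_coord (d := d) x₀,
    (chartAt (EuclideanSpace ℝ (Fin d)) x₀).open_source.mem_nhds (mem_chart_source _ x₀)]
    with y hy hys
  have h2 := TangentBundle.continuousLinearMapAt_trivializationAt (I := 𝓡 d) hys
  have h3 := congrArg (fun L : TangentSpace (𝓡 d) y →L[ℝ] EuclideanSpace ℝ (Fin d) ↦ L (R y)) h2
  ext i
  simp only [hy, Complex.ofReal_re]
  refine Eq.trans ?_ (congrArg (fun v : EuclideanSpace ℝ (Fin d) ↦ v i) h3)
  simp only
  rw [Trivialization.continuousLinearMapAt_apply, Trivialization.linearMapAt_apply]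
  rw [if_pos]
  simpa using hys

/-- Derivations of the algebra of smooth complex valued functions are complex vector fields. -/
theorem exists_field {δ : CFun d M → CFun d M} (hδ : ∀ x, IsPointDer x fun f ↦ δ f x) :
    ∃ X : CVField d M, ∀ (f : CFun d M) x, X.lie f x = δ f x := by
  -- The components at `x` are dictated by the values of `δ` on the coordinates centered at `x`;
  -- `IsPointDer.ext` then gives agreement on all functions.
  let R : ∀ x : M, TangentSpace (𝓡 d) x := fun x ↦
    (EuclideanSpace.equiv (Fin d) ℝ).symm fun i ↦ (δ (ofRealFun (coord d x i)) x).re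
  let J : ∀ x : M, TangentSpace (𝓡 d) x := fun x ↦
    (EuclideanSpace.equiv (Fin d) ℝ).symm fun i ↦ (δ (ofRealFun (coord d x i)) x).im
  have key : ∀ x (f : CFun d M), ptD (R x) f + Complex.I * ptD (J x) f = δ f x := fun x ↦ by
    refine (isPointDer_ptD (R x) (J x)).ext (hδ x) fun i ↦ ?_
    change ptD (R x) (fun z ↦ (coord d x i z : ℂ)) +
      Complex.I * ptD (J x) (fun z ↦ (coord d x i z : ℂ)) = _
    rw [ptD_coord, ptD_coord, mul_comm]
    exact Complex.re_add_im _
  -- Real functions have real derivatives along `R` and `J`, so these are the real and imaginary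
  -- parts of the smooth function `δ f`.
  have hreal : ∀ (f : C^∞⟮𝓡 d, M; 𝓘(ℝ, ℝ), ℝ⟯) x,
      ptD (R x) (fun y ↦ (f y : ℂ)) = ((δ (ofRealFun f) x).re : ℂ) ∧
      ptD (J x) (fun y ↦ (f y : ℂ)) = ((δ (ofRealFun f) x).im : ℂ) := fun f x ↦ by
    have h0 := key x (ofRealFun f)
    have h1 := ptD_ofReal_im (R x) (mdiffAt f.contMDiff x)
    have h2 := ptD_ofReal_im (J x) (mdiffAt f.contMDiff x)
    change ptD (R x) (fun y ↦ (f y : ℂ)) + Complex.I * ptD (J x) (fun y ↦ (f y : ℂ)) = _ at h0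
    rw [← h0]
    constructor <;> apply Complex.ext <;> simp [h1, h2]
  have hre : ContDiff ℝ ∞ fun z : ℂ ↦ (z.re : ℂ) :=
    Complex.ofRealCLM.contDiff.comp Complex.reCLM.contDiff
  have him : ContDiff ℝ ∞ fun z : ℂ ↦ (z.im : ℂ) :=
    Complex.ofRealCLM.contDiff.comp Complex.imCLM.contDiff
  refine ⟨⟨⟨R, smooth_field fun f ↦ ?_⟩, ⟨J, smooth_field fun f ↦ ?_⟩⟩, fun f x ↦ key x f⟩
  · simp_rw [fun x ↦ (hreal f x).1]
    exact hre.contMDiff.comp (δ (ofRealFun f)).contMDiff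
  · simp_rw [fun x ↦ (hreal f x).2]
    exact him.contMDiff.comp (δ (ofRealFun f)).contMDiff

end Fields

/-- A derivation of an algebra with matrix units is inner. -/
theorem matrixUnits_derivation {A : Type*} [Ring A] {e δ : Fin n → Fin n → A}
    (he : ∀ i j k l, e i j * e k l = if j = k then e i l else 0)
    (h1 : ∑ i, e i i = 1)
    (hδ : ∀ i j k l, δ i j * e k l + e i j * δ k l = if j = k then δ i l else 0) (k l : Fin n) :
    (∑ i, ∑ j, δ i j * e j i) * e k l - e k l * (∑ i, ∑ j, δ i j * e j i) = n • δ k l := by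
  have a1 : (∑ i, ∑ j, δ i j * e j i) * e k l = ∑ j, δ k j * e j l := by
    simp only [Finset.sum_mul, mul_assoc, he, mul_ite, mul_zero]
    rw [Finset.sum_comm]
    simp
  -- The product rule trades `e k l * δ i j` for `-δ k l * e i j` plus a term present only for `l =
  -- i`. The factor `n` arises because `∑ i, ∑ j, e i j * e j i` is `n` times the unit.
  have a2 : e k l * (∑ i, ∑ j, δ i j * e j i) = ∑ j, δ k j * e j l - n • δ k l := by
    have : ∀ i j, e k l * (δ i j * e j i) = (if l = i then δ k j * e j i else 0) -
        δ k l * e i i := fun i j ↦ by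
      rw [← mul_assoc, eq_sub_of_add_eq' (hδ k l i j), sub_mul, mul_assoc (δ k l), he, if_pos rfl]
      split_ifs <;> simp
    simp only [Finset.mul_sum, this, Finset.sum_sub_distrib]
    congr 1
    · rw [Finset.sum_comm]
      simp
    · simp only [Finset.sum_const, Finset.card_univ, Fintype.card_fin, ← Finset.smul_sum,
        ← Finset.mul_sum, h1, mul_one]
  rw [a1, a2]
  abel

/-! ### Frames, sections of the endomorphism bundle and the center -/

section Sections

variable [IsManifold (𝓡 d) ∞ M] [T2Space M] [VectorBundle ℝ F V] [NeZero n]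
  [FiniteDimensional ℂ F] [Fact (Module.finrank ℂ F = n)]

namespace IsFrameAt

variable {σ : SUStructure d F V n} {t : Fin n → Sec d F V} {x : M}

/-- The orthonormal basis given by a frame. -/
def basis (h : IsFrameAt σ t x) : OrthonormalBasis (Fin n) ℂ (V x) :=
  haveI := finiteDimensional_fiber (F := F) (V := V) x
  OrthonormalBasis.mk h.orthonormal (h.orthonormal.linearIndependent.span_eq_top_of_card_eq_finrank'
    (by rw [finrank_fiber (F := F) (V := V) (n := n) Fact.out x, Fintype.card_fin])).ge

@[simp] theorem basis_apply (h : IsFrameAt σ t x) (i : Fin n) : h.basis i = t i x := by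
  simp [basis]

theorem inner_eq (h : IsFrameAt σ t x) (i j : Fin n) :
    (inner ℂ (t i x) (t j x) : ℂ) = if i = j then 1 else 0 :=
  orthonormal_iff_ite.1 h.orthonormal i j

theorem sum_eq (h : IsFrameAt σ t x) (v : V x) :
    ∑ i, (inner ℂ (t i x) v : ℂ) • t i x = v := by
  simpa using h.basis.sum_repr' v

theorem tr_eq (h : IsFrameAt σ t x) (S : EndAlg d F V) :
    tr S x = ∑ i, (inner ℂ (t i x) (S.1 x (t i x)) : ℂ) := by
  rw [tr, LinearMap.trace_eq_sum_inner _ h.basis]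
  simp

end IsFrameAt

@[simp] theorem smulSec_apply (f : CFun d M) (s : Sec d F V) (x : M) :
    smulSec f s x = f x • s x := rfl

@[simp] theorem act_apply (S : EndAlg d F V) (s : Sec d F V) (x : M) :
    act S s x = S.1 x (s x) := rfl

@[simp] theorem scalar_apply (f : CFun d M) (x : M) :
    (scalar f : EndAlg d F V).1 x = f x • ContinuousLinearMap.id ℂ (V x) := rfl

@[simp] theorem EndAlg.mul_apply (S T : EndAlg d F V) (x : M) : (S * T).1 x = S.1 x * T.1 x := rfl

@[simp] theorem EndAlg.add_apply (S T : EndAlg d F V) (x : M) : (S + T).1 x = S.1 x + T.1 x := rfl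

@[simp] theorem EndAlg.sub_apply (S T : EndAlg d F V) (x : M) : (S - T).1 x = S.1 x - T.1 x := rfl

@[simp] theorem EndAlg.neg_apply (S : EndAlg d F V) (x : M) : (-S).1 x = -S.1 x := rfl

@[simp] theorem EndAlg.smul_apply (c : ℂ) (S : EndAlg d F V) (x : M) :
    (c • S).1 x = c • S.1 x := rfl

theorem EndAlg.ext {S T : EndAlg d F V} (h : ∀ x, S.1 x = T.1 x) : S = T :=
  Subtype.ext (funext h)

/-- Evaluation at a point, as a ring homomorphism. -/
def evalAt (x : M) : EndAlg d F V →+* (V x →L[ℂ] V x) where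
  toFun S := S.1 x
  map_one' := rfl
  map_mul' _ _ := rfl
  map_zero' := rfl
  map_add' _ _ := rfl

theorem EndAlg.sum_apply {ι : Type*} (s : Finset ι) (S : ι → EndAlg d F V) (x : M) :
    (∑ i ∈ s, S i).1 x = ∑ i ∈ s, (S i).1 x := map_sum (evalAt x) S s

theorem Sec.sum_apply {ι : Type*} (u : Finset ι) (s : ι → Sec d F V) (x : M) :
    (∑ i ∈ u, s i) x = ∑ i ∈ u, s i x := by
  exact (congrFun (map_sum (ContMDiffSection.coeAddHom (𝓡 d) F ∞ V) s u) x).trans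
    (Finset.sum_apply _ _ _)

/-- The smooth function `⟨s, t⟩`. -/
def innerFun (σ : SUStructure d F V n) (s t : Sec d F V) : CFun d M := ⟨_, σ.smooth_inner s t⟩

@[simp] theorem innerFun_apply (σ : SUStructure d F V n) (s t : Sec d F V) (x : M) :
    innerFun σ s t x = inner ℂ (s x) (t x) := rfl

variable [ContMDiffVectorBundle ∞ F V (𝓡 d)]

open Topology in
/-- Families of endomorphisms that map smooth sections to smooth sections are smooth. -/
theorem mem_endSubalgebra {S : ∀ x, V x →L[ℂ] V x}
    (hS : ∀ (s : Sec d F V) x, SmoothSecAt d F (fun x ↦ S x (s x)) x) :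
    S ∈ endSubalgebra d F V := by
  intro x₀
  rw [contMDiffAt_section]
  set e := trivializationAt F V x₀ with he
  have hU := e.open_baseSet
  have hx₀ : x₀ ∈ e.baseSet := FiberBundle.mem_baseSet_trivializationAt' x₀
  let b := Module.finBasis ℂ F
  have hs : ∀ i, ∀ x ∈ e.baseSet, SmoothSecAt d F (fun x ↦ e.symm x (b i)) x := by
    intro i x hx
    rw [SmoothSecAt, e.contMDiffAt_section_iff hx]
    refine (contMDiffAt_const (c := b i)).congr_of_eventuallyEq ?_
    filter_upwards [hU.mem_nhds hx] with y hy
    simp [e.apply_mk_symm hy]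
  obtain ⟨t, ht⟩ := exists_extend hU hx₀ hs
  let c : Fin (Module.finrank ℂ F) → F →L[ℂ] ℂ := fun i ↦ LinearMap.toContinuousLinearMap (b.coord i)
  -- In the trivialization `S` is the sum of the coordinate functionals tensored with the images of
  -- the basis vectors, which are smooth by hypothesis.
  have key : ContMDiffAt (𝓡 d) 𝓘(ℝ, F →L[ℂ] F) ∞ (fun y ↦ ∑ i,
      (ContinuousLinearMap.smulRightL ℂ F F (c i)) (e ⟨y, S y (t i y)⟩).2) x₀ := by
    refine contMDiffAt_finsetSum fun i _ ↦ ?_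
    have h1 := (contMDiffAt_section x₀).1 (hS (t i) x₀)
    have h2 : ContDiff ℝ ∞ (ContinuousLinearMap.smulRightL ℂ F F (c i)) :=
      ((ContinuousLinearMap.smulRightL ℂ F F (c i)).restrictScalars ℝ).contDiff
    exact h2.contMDiff.contMDiffAt.comp x₀ h1
  refine key.congr_of_eventuallyEq ?_
  filter_upwards [ht, hU.mem_nhds hx₀] with y hy hyU
  simp only [hom_trivializationAt_apply]
  rw [ContinuousLinearMap.inCoordinates_eq hyU hyU]
  ext v
  have hv : e.symm y v = ∑ i, b.repr v i • e.symm y (b i) := by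
    conv_lhs => rw [← b.sum_repr v]
    simp only [← e.symmL_apply (R := ℂ) hyU, map_sum, map_smul]
  have he' : ∀ w : V y, (e ⟨y, w⟩).2 = e.continuousLinearEquivAt ℂ y hyU w := fun _ ↦ rfl
  have hw : (e ⟨y, S y (e.symm y v)⟩).2 = ∑ i, b.repr v i • (e ⟨y, S y (e.symm y (b i))⟩).2 := by
    simp only [he', hv, map_sum, map_smul]
  simp only [hy]
  rw [_root_.sum_apply]
  exact hw

end Sections

section Sections

variable [IsManifold (𝓡 d) ∞ M] [T2Space M] [VectorBundle ℝ F V] [NeZero n]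
  [FiniteDimensional ℂ F] [Fact (Module.finrank ℂ F = n)] [ContMDiffVectorBundle ∞ F V (𝓡 d)]

/-- The section `v ↦ ⟨t, v⟩ s` of the endomorphism bundle. -/
def rankOneSec (σ : SUStructure d F V n) (s t : Sec d F V) : EndAlg d F V :=
  ⟨fun x ↦ InnerProductSpace.rankOne ℂ (s x) (t x), by
    have : NeZero n := inferInstance
    refine mem_endSubalgebra fun u x ↦ ?_
    exact (smulSec (innerFun σ t u) s).contMDiff x⟩

@[simp] theorem rankOneSec_apply (σ : SUStructure d F V n) (s t : Sec d F V) (x : M) (v : V x) :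
    (rankOneSec σ s t).1 x v = (inner ℂ (t x) v : ℂ) • s x := rfl

/-- With `χ` vanishing wherever `t` fails to be a frame, expansions in the frame become global
identities after multiplication by `χ`; see `cutoff_sec` and `cutoff_end`. -/
theorem exists_frame_cutoff (σ : SUStructure d F V n) (x₀ : M) :
    ∃ (t : Fin n → Sec d F V) (χ : CFun d M), (χ : M → ℂ) =ᶠ[nhds x₀] 1 ∧
      (∀ y, χ y ≠ 0 → IsFrameAt σ t y) ∧ ∀ᶠ y in nhds x₀, IsFrameAt σ t y := by
  obtain ⟨t, ht⟩ := exists_frame (NeZero.pos n) Fact.out σ x₀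
  obtain ⟨χ, h1, h2, -⟩ := exists_cutoff (d := d) ht
  refine ⟨t, ofRealFun χ, ?_, fun y hy ↦ h2 (subset_tsupport _ ?_), ht⟩
  · filter_upwards [h1] with y hy
    simp [hy]
  · simpa using hy

/-- A choice of a frame near a given point. -/
theorem exists_frame_at (σ : SUStructure d F V n) (x₀ : M) :
    ∃ t : Fin n → Sec d F V, IsFrameAt σ t x₀ := by
  obtain ⟨t, ht⟩ := exists_frame (NeZero.pos n) Fact.out σ x₀
  exact ⟨t, ht.self_of_nhds⟩

theorem nontrivial_fiber (_σ : SUStructure d F V n) (x : M) : Nontrivial (V x) := by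
  apply Module.nontrivial_of_finrank_pos (R := ℂ)
  rw [finrank_fiber (F := F) (V := V) (n := n) Fact.out x]
  exact NeZero.pos n

theorem exists_sec (σ : SUStructure d F V n) {x : M} (v : V x) : ∃ s : Sec d F V, s x = v := by
  obtain ⟨t, ht⟩ := exists_frame_at σ x
  refine ⟨∑ i, smulSec (constFun (inner ℂ (t i x) v)) (t i), ?_⟩
  rw [Sec.sum_apply]
  exact ht.sum_eq v

theorem EndAlg.ext_sec (σ : SUStructure d F V n) {S T : EndAlg d F V}
    (h : ∀ (s : Sec d F V) x, S.1 x (s x) = T.1 x (s x)) : S = T := by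
  refine EndAlg.ext fun x ↦ ContinuousLinearMap.ext fun v ↦ ?_
  obtain ⟨s, rfl⟩ := exists_sec σ v
  exact h s x

theorem cutoff_sec (σ : SUStructure d F V n) {t : Fin n → Sec d F V} {χ : CFun d M}
    (h : ∀ y, χ y ≠ 0 → IsFrameAt σ t y) (s : Sec d F V) :
    smulSec χ s = ∑ i, smulSec (χ * innerFun σ (t i) s) (t i) := by
  ext y
  rw [Sec.sum_apply]
  simp only [smulSec_apply, ContMDiffMap.coe_mul, Pi.mul_apply, innerFun_apply, mul_smul,
    ← Finset.smul_sum]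
  by_cases hy : χ y = 0
  · simp [hy]
  · rw [(h y hy).sum_eq]

theorem cutoff_end (σ : SUStructure d F V n) {t : Fin n → Sec d F V} {χ : CFun d M}
    (h : ∀ y, χ y ≠ 0 → IsFrameAt σ t y) (S : EndAlg d F V) :
    scalar χ * S = ∑ i, ∑ j, scalar (χ * innerFun σ (t i) (act S (t j))) *
      rankOneSec σ (t i) (t j) := by
  refine EndAlg.ext_sec σ fun s y ↦ ?_
  simp only [EndAlg.sum_apply, _root_.sum_apply, EndAlg.mul_apply, scalar_apply,
    mul_apply_eq_comp, _root_.smul_apply, ContinuousLinearMap.id_apply,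
    rankOneSec_apply, ContMDiffMap.coe_mul, Pi.mul_apply, innerFun_apply, act_apply]
  by_cases hy : χ y = 0
  · simp [hy]
  · have hf := h y hy
    simp only [mul_smul, ← Finset.smul_sum]
    congr 1
    rw [Finset.sum_comm]
    conv_lhs => rw [← hf.sum_eq (s y), map_sum]
    refine Finset.sum_congr rfl fun j _ ↦ ?_
    rw [map_smul]
    conv_lhs => rw [← hf.sum_eq (S.1 y (t j y)), Finset.smul_sum]
    exact Finset.sum_congr rfl fun i _ ↦ smul_comm _ _ _

/-- Linear operators on sections are given by sections of the endomorphism bundle. -/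
theorem exists_endo (σ : SUStructure d F V n) (T : Sec d F V → Sec d F V)
    (hadd : ∀ s t, T (s + t) = T s + T t)
    (hsmul : ∀ (f : CFun d M) s x, T (smulSec f s) x = f x • T s x) :
    ∃ S : EndAlg d F V, ∀ s x, S.1 x (s x) = T s x := by
  have key : ∀ x, ∃ L : V x →L[ℂ] V x, ∀ s, L (s x) = T s x := fun x ↦ by
    obtain ⟨t, χ, h1, h2, h3⟩ := exists_frame_cutoff σ x
    -- Linearity over functions lets `s` be replaced by `χ s`, which expands globally in the frame;
    -- so `T s x` depends only on `s x`.
    refine ⟨∑ i, InnerProductSpace.rankOne ℂ (T (t i) x) (t i x), fun s ↦ ?_⟩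
    have h4 : T s x = T (smulSec χ s) x := by
      rw [hsmul, h1.self_of_nhds, Pi.one_apply, one_smul]
    let T' : Sec d F V →+ Sec d F V := AddMonoidHom.mk' T hadd
    have h5 : T (smulSec χ s) = ∑ i, T (smulSec (χ * innerFun σ (t i) s) (t i)) := by
      rw [cutoff_sec σ h2]
      exact map_sum T' _ _
    rw [h4, h5, Sec.sum_apply]
    simp only [hsmul, ContMDiffMap.coe_mul, Pi.mul_apply, innerFun_apply, h1.self_of_nhds,
      Pi.one_apply, one_mul, _root_.sum_apply, InnerProductSpace.rankOne_apply]
  choose L hL using key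
  exact ⟨⟨L, mem_endSubalgebra fun s x ↦ by
    simp_rw [hL]; exact (T s).contMDiff x⟩, fun s x ↦ hL x s⟩

/-- Endomorphisms of a fiber which commute with all values of sections are scalars. -/
theorem exists_scalar_of_commute (σ : SUStructure d F V n) {x : M} {b : V x →L[ℂ] V x}
    (hb : ∀ S : EndAlg d F V, b * S.1 x = S.1 x * b) {t : Fin n → Sec d F V}
    (ht : IsFrameAt σ t x) : b = (inner ℂ (t 0 x) (b (t 0 x)) : ℂ) • ContinuousLinearMap.id ℂ _ := by
  ext v
  obtain ⟨s, rfl⟩ := exists_sec σ v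
  -- Commuting with `v ↦ ⟨t 0, v⟩ s` and evaluating at the unit vector `t 0 x` gives `b s = ⟨t 0, b
  -- (t 0)⟩ s`.
  have h := congrArg (fun L : V x →L[ℂ] V x ↦ L (t 0 x)) (hb (rankOneSec σ s (t 0)))
  simp only [mul_apply_eq_comp, rankOneSec_apply, ht.inner_eq, if_true,
    one_smul] at h
  simpa using h

theorem eq_zero_of_commute (σ : SUStructure d F V n) {x : M} {b : V x →L[ℂ] V x}
    (hb : ∀ S : EndAlg d F V, b * S.1 x = S.1 x * b)
    (htr : LinearMap.trace ℂ (V x) (b : V x →ₗ[ℂ] V x) = 0) : b = 0 := by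
  obtain ⟨t, ht⟩ := exists_frame_at σ x
  have h := exists_scalar_of_commute σ hb ht
  rw [h] at htr
  have := finiteDimensional_fiber (F := F) (V := V) x
  have h1 : ((inner ℂ (t 0 x) (b (t 0 x)) : ℂ) • ContinuousLinearMap.id ℂ (V x) :
      V x →L[ℂ] V x) = ((inner ℂ (t 0 x) (b (t 0 x)) : ℂ) • LinearMap.id : V x →ₗ[ℂ] V x) := rfl
  rw [h1, map_smul, LinearMap.trace_id, finrank_fiber (F := F) (V := V) (n := n) Fact.out x,
    smul_eq_mul, mul_eq_zero] at htr
  rw [h, htr.resolve_right (Nat.cast_ne_zero.2 (NeZero.ne n)), zero_smul]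

theorem eq_zero_of_commute_of_tr (σ : SUStructure d F V n) {a : EndAlg d F V}
    (ha : ∀ S, a * S = S * a) (htr : ∀ x, tr a x = 0) : a = 0 :=
  EndAlg.ext fun x ↦ eq_zero_of_commute σ (fun S ↦ congrArg (fun T ↦ T.1 x) (ha S)) (htr x)

/-- The center of the algebra of sections of the endomorphism bundle consists of functions. -/
theorem exists_eq_scalar (σ : SUStructure d F V n) {a : EndAlg d F V} (ha : ∀ S, a * S = S * a) :
    ∃ f : CFun d M, a = scalar f := by
  have key : ∀ x, ∃ c : ℂ, a.1 x = c • ContinuousLinearMap.id ℂ (V x) := fun x ↦ by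
    obtain ⟨t, ht⟩ := exists_frame_at σ x
    exact ⟨_, exists_scalar_of_commute σ (fun S ↦ congrArg (fun T ↦ T.1 x) (ha S)) ht⟩
  choose c hc using key
  refine ⟨⟨c, fun x₀ ↦ ?_⟩, EndAlg.ext hc⟩
  obtain ⟨t, -, -, -, ht⟩ := exists_frame_cutoff σ x₀
  refine ((innerFun σ (t 0) (act a (t 0))).contMDiff x₀).congr_of_eventuallyEq ?_
  filter_upwards [ht] with y hy
  simp only [innerFun_apply, act_apply, hc, _root_.smul_apply, ContinuousLinearMap.id_apply,
    inner_smul_right, hy.inner_eq, if_true, mul_one]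

theorem scalar_injective (σ : SUStructure d F V n) :
    Function.Injective (scalar : CFun d M → EndAlg d F V) := by
  intro f g h
  ext x
  have := nontrivial_fiber σ x
  obtain ⟨v, hv⟩ := exists_ne (0 : V x)
  have h1 := congrArg (fun T : EndAlg d F V ↦ T.1 x v) h
  simp only [scalar_apply, _root_.smul_apply, ContinuousLinearMap.id_apply] at h1
  exact smul_left_injective ℂ hv h1

theorem scalar_commute (f : CFun d M) (S : EndAlg d F V) : scalar f * S = S * scalar f := by
  refine EndAlg.ext fun x ↦ ContinuousLinearMap.ext fun v ↦ ?_
  simp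

theorem scalar_mem_center (f : CFun d M) :
    (scalar f : EndAlg d F V) ∈ Subalgebra.center ℂ (EndAlg d F V) :=
  Subalgebra.mem_center_iff.2 fun S ↦ (scalar_commute f S).symm

theorem scalar_add (f g : CFun d M) : (scalar (f + g) : EndAlg d F V) = scalar f + scalar g :=
  EndAlg.ext fun x ↦ by simp [add_smul]

theorem scalar_mul (f g : CFun d M) : (scalar (f * g) : EndAlg d F V) = scalar f * scalar g :=
  EndAlg.ext fun x ↦ ContinuousLinearMap.ext fun v ↦ by simp [smul_smul, mul_comm]

/-- Traceless endomorphisms of a fiber are determined by their commutators. -/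
theorem eq_of_commutator_eq (σ : SUStructure d F V n) {x : M} {a b : V x →L[ℂ] V x}
    (ha : LinearMap.trace ℂ (V x) (a : V x →ₗ[ℂ] V x) = 0)
    (hb : LinearMap.trace ℂ (V x) (b : V x →ₗ[ℂ] V x) = 0)
    (h : ∀ S : EndAlg d F V, a * S.1 x - S.1 x * a = b * S.1 x - S.1 x * b) : a = b := by
  refine sub_eq_zero.1 (eq_zero_of_commute σ (fun S ↦ ?_) ?_)
  · have := h S
    rw [sub_eq_sub_iff_add_eq_add] at this
    rw [sub_mul, mul_sub, sub_eq_sub_iff_add_eq_add, add_comm (S.1 x * _), this]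
  · rw [ContinuousLinearMap.toLinearMap_sub, map_sub, ha, hb, sub_zero]

/-- Families of endomorphisms which are locally smooth define global sections. -/
theorem exists_of_locally {b : ∀ x, V x →L[ℂ] V x}
    (h : ∀ x₀, ∃ S : EndAlg d F V, ∀ᶠ y in nhds x₀, b y = S.1 y) :
    ∃ S : EndAlg d F V, ∀ x, S.1 x = b x := by
  refine ⟨⟨b, fun x ↦ ?_⟩, fun x ↦ rfl⟩
  obtain ⟨S, hS⟩ := h x
  refine ContMDiffAt.congr_of_eventuallyEq (S.2 x) ?_
  filter_upwards [hS] with y hy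
  rw [hy]

/-! ### Function-linear derivations are inner -/

/-- The traceless generator of an inner derivation in terms of a frame. -/
def localGenerator (σ : SUStructure d F V n) (D : EndAlg d F V →+ EndAlg d F V)
    (t : Fin n → Sec d F V) : EndAlg d F V :=
  (n : ℂ)⁻¹ • ∑ i, ∑ j, D (rankOneSec σ (t i) (t j)) * rankOneSec σ (t j) (t i)

/-- At a point where `t` is a frame, its rank one endomorphisms are matrix units, so
`matrixUnits_derivation` handles them; `cutoff_end` and linearity over functions extend the formula
to all `S`. -/
theorem localGenerator_spec (σ : SUStructure d F V n) (D : EndAlg d F V →+ EndAlg d F V)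
    (hmul : ∀ S T, D (S * T) = D S * T + S * D T)
    (hlin : ∀ (f : CFun d M) S, D (scalar f * S) = scalar f * D S)
    {t : Fin n → Sec d F V} {χ : CFun d M} (hχ : ∀ y, χ y ≠ 0 → IsFrameAt σ t y)
    {x : M} (hx : χ x ≠ 0) :
    tr (localGenerator σ D t) x = 0 ∧ ∀ S, (D S).1 x =
      (localGenerator σ D t).1 x * S.1 x - S.1 x * (localGenerator σ D t).1 x := by
  have n0 : (n : ℂ) ≠ 0 := Nat.cast_ne_zero.2 (NeZero.ne n)
  have ht := hχ x hx
  set a := localGenerator σ D t with ha_def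
  let e : Fin n → Fin n → (V x →L[ℂ] V x) := fun i j ↦ (rankOneSec σ (t i) (t j)).1 x
  let δ : Fin n → Fin n → (V x →L[ℂ] V x) := fun i j ↦ (D (rankOneSec σ (t i) (t j))).1 x
  -- `D` acts on global sections, so it needs the multiplication rule everywhere, also where `t` is
  -- not orthonormal; only afterwards is it evaluated at `x`.
  have hE : ∀ i j k l, rankOneSec σ (t i) (t j) * rankOneSec σ (t k) (t l) =
      scalar (innerFun σ (t j) (t k)) * rankOneSec σ (t i) (t l) := fun i j k l ↦ by
    refine EndAlg.ext fun y ↦ ContinuousLinearMap.ext fun v ↦ ?_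
    simp [smul_smul, mul_comm]
  have he : ∀ i j k l, e i j * e k l = if j = k then e i l else 0 := fun i j k l ↦ by
    have := congrArg (fun S ↦ S.1 x) (hE i j k l)
    simp only [EndAlg.mul_apply, scalar_apply, innerFun_apply, ht.inner_eq] at this
    refine this.trans ?_
    split_ifs
    · ext v; simp [e]
    · simp
  have h1 : ∑ i, e i i = 1 := by
    ext v
    rw [_root_.sum_apply]
    exact ht.sum_eq v
  have hδ : ∀ i j k l, δ i j * e k l + e i j * δ k l = if j = k then δ i l else 0 := by
    intro i j k l
    have h := hmul (rankOneSec σ (t i) (t j)) (rankOneSec σ (t k) (t l))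
    rw [hE, hlin] at h
    refine (congrArg (fun S ↦ S.1 x) h.symm).trans ?_
    simp only [EndAlg.mul_apply, scalar_apply, innerFun_apply, ht.inner_eq]
    split_ifs
    · ext v; simp [δ]
    · simp
  have hm := matrixUnits_derivation he h1 hδ
  have ha : a.1 x = (n : ℂ)⁻¹ • ∑ i, ∑ j, δ i j * e j i := by
    simp only [a, localGenerator, EndAlg.smul_apply, EndAlg.sum_apply, EndAlg.mul_apply, e, δ]
  have hder : ∀ k l, δ k l = a.1 x * e k l - e k l * a.1 x := fun k l ↦ by
    rw [ha, smul_mul_assoc, mul_smul_comm, ← smul_sub, hm, ← Nat.cast_smul_eq_nsmul ℂ, smul_smul,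
      inv_mul_cancel₀ n0, one_smul]
  refine ⟨?_, fun S ↦ ?_⟩
  · let τ : (V x →L[ℂ] V x) →ₗ[ℂ] ℂ :=
      (LinearMap.trace ℂ (V x)).comp (ContinuousLinearMap.coeLM ℂ)
    have hτ : ∀ A B, τ (A * B) = τ (B * A) := fun A B ↦
      LinearMap.trace_mul_comm ℂ (A : V x →ₗ[ℂ] V x) (B : V x →ₗ[ℂ] V x)
    -- Antisymmetric in `i` and `j`, so the double sum defining the trace of the generator cancels.
    have h2 : ∀ i j, τ (δ i j * e j i) = τ (a.1 x * e i i) - τ (a.1 x * e j j) := fun i j ↦ by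
      rw [hder, sub_mul, map_sub, mul_assoc, he, if_pos rfl, hτ (e i j * a.1 x), ← mul_assoc, he,
        if_pos rfl, hτ (e j j)]
    change τ (a.1 x) = 0
    rw [ha]
    simp only [map_smul, map_sum, h2, Finset.sum_sub_distrib]
    rw [Finset.sum_comm, sub_self, smul_zero]
  · let c : Fin n → Fin n → CFun d M := fun i j ↦ χ * innerFun σ (t i) (act S (t j))
    have hS := cutoff_end σ hχ S
    have hD := congrArg D hS
    simp only [map_sum, hlin] at hD
    have hsm : ∀ (f : CFun d M) (T : EndAlg d F V), (scalar f * T).1 x = f x • T.1 x :=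
      fun f T ↦ by ext v; simp
    have hS' := congrArg (fun T ↦ T.1 x) hS
    have hD' := congrArg (fun T ↦ T.1 x) hD
    simp only [EndAlg.sum_apply, hsm] at hS' hD'
    have hfin : χ x • (D S).1 x = χ x • (a.1 x * S.1 x - S.1 x * a.1 x) := by
      rw [hD', smul_sub, ← mul_smul_comm, ← smul_mul_assoc, hS']
      simp only [Finset.mul_sum, Finset.sum_mul, ← Finset.sum_sub_distrib, mul_smul_comm,
        smul_mul_assoc, ← smul_sub]
      exact Finset.sum_congr rfl fun i _ ↦ Finset.sum_congr rfl fun j _ ↦ by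
        rw [← hder i j]
    exact smul_right_injective _ hx hfin

/-- Derivations of the algebra of sections of the endomorphism bundle which are linear over
functions are inner. -/
theorem exists_inner (σ : SUStructure d F V n) (D : EndAlg d F V →+ EndAlg d F V)
    (hmul : ∀ S T, D (S * T) = D S * T + S * D T)
    (hlin : ∀ (f : CFun d M) S, D (scalar f * S) = scalar f * D S) :
    ∃ a : EndAlg d F V, (∀ x, tr a x = 0) ∧ ∀ S, D S = a * S - S * a := by
  choose t χ h1 h2 h3 using exists_frame_cutoff σ
  have hχ : ∀ x, χ x x ≠ 0 := fun x ↦ by rw [(h1 x).self_of_nhds]; exact one_ne_zero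
  have hs := fun x y (hxy : χ x y ≠ 0) ↦ localGenerator_spec σ D hmul hlin (h2 x) hxy
  -- Traceless generators are unique, so those of different frames agree; the pointwise choice below
  -- is therefore locally given by one smooth section.
  have ha : ∀ x y, χ x y ≠ 0 →
      (localGenerator σ D (t y)).1 y = (localGenerator σ D (t x)).1 y := fun x y hxy ↦
    eq_of_commutator_eq σ (hs y y (hχ y)).1 (hs x y hxy).1 fun S ↦
      ((hs y y (hχ y)).2 S).symm.trans ((hs x y hxy).2 S)
  obtain ⟨a, haS⟩ := exists_of_locally (b := fun x ↦ (localGenerator σ D (t x)).1 x) fun x ↦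
    ⟨localGenerator σ D (t x), by
      filter_upwards [(χ x).contMDiff.continuous.continuousAt.eventually_ne (hχ x)] with y hy
      exact ha x y hy⟩
  refine ⟨a, fun x ↦ ?_, fun S ↦ EndAlg.ext fun x ↦ ?_⟩
  · rw [tr, haS]
    exact (hs x x (hχ x)).1
  · rw [EndAlg.sub_apply, EndAlg.mul_apply, EndAlg.mul_apply, haS]
    exact (hs x x (hχ x)).2 S

/-! ### Derivations, connections on `End E` and the one-form of a connection -/

instance instSMulCenterDer {A : Type*} [Ring A] [Algebra ℂ A] :
    SMul (Subalgebra.center ℂ A) (Der A) := inferInstance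

theorem Der.leibniz {A : Type*} [Ring A] [Algebra ℂ A] (D : Der A) (a b : A) :
    D.1 (a * b) = D.1 a * b + a * D.1 b := D.2 a b

theorem Der.map_one {A : Type*} [Ring A] [Algebra ℂ A] (D : Der A) : D.1 1 = 0 := by
  have := Der.leibniz D 1 1
  simpa using this

theorem ad_apply {A : Type*} [Ring A] [Algebra ℂ A] (γ a : A) : (ad γ).1 a = γ * a - a * γ := rfl

theorem Der.add_apply {A : Type*} [Ring A] [Algebra ℂ A] (D D' : Der A) (a : A) :
    (D + D').1 a = D.1 a + D'.1 a := rfl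

theorem Der.sub_apply {A : Type*} [Ring A] [Algebra ℂ A] (D D' : Der A) (a : A) :
    (D - D').1 a = D.1 a - D'.1 a := rfl

theorem Der.smul_apply {A : Type*} [Ring A] [Algebra ℂ A] (z : Subalgebra.center ℂ A) (D : Der A)
    (a : A) : (z • D).1 a = z.1 * D.1 a := rfl

theorem Der.smul_sub {A : Type*} [Ring A] [Algebra ℂ A] (z : Subalgebra.center ℂ A)
    (D D' : Der A) : z • (D - D') = z • D - z • D' := _root_.smul_sub z D D'

theorem Der.ext {A : Type*} [Ring A] [Algebra ℂ A] {D D' : Der A} (h : ∀ a, D.1 a = D'.1 a) :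
    D = D' := Subtype.ext (LinearMap.ext h)

theorem Der.ext_sec (σ : SUStructure d F V n) {D D' : Der (EndAlg d F V)}
    (h : ∀ S (s : Sec d F V) x, (D.1 S).1 x (s x) = (D'.1 S).1 x (s x)) : D = D' :=
  Der.ext fun S ↦ EndAlg.ext_sec σ (h S)

/-- Real part of a smooth function. -/
def reFun (f : CFun d M) : C^∞⟮𝓡 d, M; 𝓘(ℝ, ℝ), ℝ⟯ :=
  ⟨fun x ↦ (f x).re, (Complex.reCLM.contDiff (n := ∞)).contMDiff.comp f.contMDiff⟩

/-- Imaginary part of a smooth function. -/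
def imFun (f : CFun d M) : C^∞⟮𝓡 d, M; 𝓘(ℝ, ℝ), ℝ⟯ :=
  ⟨fun x ↦ (f x).im, (Complex.imCLM.contDiff (n := ∞)).contMDiff.comp f.contMDiff⟩

/-- Sum of complex vector fields. -/
def CVField.add (X Y : CVField d M) : CVField d M := ⟨X.re + Y.re, X.im + Y.im⟩

/-- Product of a complex vector field with a function. -/
def CVField.smul (f : CFun d M) (X : CVField d M) : CVField d M :=
  ⟨smulField (reFun f) X.re - smulField (imFun f) X.im,
    smulField (reFun f) X.im + smulField (imFun f) X.re⟩

theorem CVField.lie_const (X : CVField d M) (c : ℂ) (x : M) :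
    X.lie (constFun c : CFun d M) x = 0 :=
  (isPointDer_ptD (X.re x) (X.im x)).const c

section Connection

variable {cov : VField d M → Sec d F V → Sec d F V}

/-- The covariant derivative along a complex vector field, as a section. -/
def covCSec (cov : VField d M → Sec d F V → Sec d F V) (X : CVField d M) (s : Sec d F V) :
    Sec d F V := cov X.re s + smulSec (constFun Complex.I) (cov X.im s)

theorem covCSec_apply (X : CVField d M) (s : Sec d F V) (x : M) :
    covCSec cov X s x = covC cov X s x := rfl

theorem IsConnection.covC_add (hc : IsConnection cov) (X : CVField d M) (s t : Sec d F V) (x : M) :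
    covC cov X (s + t) x = covC cov X s x + covC cov X t x := by
  simp only [covC, hc.add_sec, ContMDiffSection.coe_add, Pi.add_apply, smul_add]
  abel

theorem IsConnection.covC_leibniz (hc : IsConnection cov) (X : CVField d M) (f : CFun d M)
    (s : Sec d F V) (x : M) :
    covC cov X (smulSec f s) x = X.lie f x • s x + f x • covC cov X s x := by
  simp only [covC, hc.leibniz, CVField.lie]
  module

theorem IsConnection.zero_field (hc : IsConnection cov) (s : Sec d F V) : cov 0 s = 0 := by
  simpa using hc.add_field 0 0 s

theorem IsConnection.neg_field (hc : IsConnection cov) (X : VField d M) (s : Sec d F V) :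
    cov (-X) s = -cov X s := by
  have := hc.add_field X (-X) s
  rw [add_neg_cancel, hc.zero_field] at this
  exact (neg_eq_of_add_eq_zero_right this.symm).symm

theorem IsConnection.covC_add_field (hc : IsConnection cov) (X Y : CVField d M) (s : Sec d F V)
    (x : M) : covC cov (X.add Y) s x = covC cov X s x + covC cov Y s x := by
  simp only [covC, CVField.add, hc.add_field, ContMDiffSection.coe_add, Pi.add_apply, smul_add]
  abel

theorem IsConnection.covC_smul_field (hc : IsConnection cov) (f : CFun d M) (X : CVField d M)
    (s : Sec d F V) (x : M) : covC cov (X.smul f) s x = f x • covC cov X s x := by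
  have hr : ∀ (r : ℝ) (v : V x), r • v = (r : ℂ) • v := fun _ _ ↦ rfl
  have h1 : f x = ((f x).re : ℂ) + ((f x).im : ℂ) * Complex.I := (Complex.re_add_im _).symm
  have h2 : Complex.I * Complex.I = -1 := Complex.I_mul_I
  simp only [covC, CVField.smul, sub_eq_add_neg, hc.add_field, hc.neg_field,
    ContMDiffSection.coe_add, ContMDiffSection.coe_neg, Pi.add_apply, Pi.neg_apply,
    hc.smul_field, hr]
  change ((f x).re : ℂ) • _ + -(((f x).im : ℂ) • _) + Complex.I • (((f x).re : ℂ) • _ +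
    ((f x).im : ℂ) • _) = _
  rw [h1]
  simp only [smul_add, add_smul, smul_smul, Complex.add_re, Complex.ofReal_re, Complex.mul_re,
    Complex.I_re, mul_zero, Complex.ofReal_im, Complex.I_im, mul_one, sub_self, add_zero,
    Complex.add_im, Complex.mul_im, zero_add]
  rw [add_mul, mul_assoc, h2, mul_comm Complex.I, mul_comm Complex.I]
  module

/-- The covariant derivative of endomorphisms is a derivation. -/
theorem exists_endDer (σ : SUStructure d F V n) (hc : IsConnection cov) (X : CVField d M) :
    ∃ D : Der (EndAlg d F V), ∀ S s x, (D.1 S).1 x (s x) = endCov cov X S s x := by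
  have key : ∀ S : EndAlg d F V, ∃ T : EndAlg d F V, ∀ s x, T.1 x (s x) = endCov cov X S s x := by
    intro S
    refine exists_endo σ (fun s ↦ covCSec cov X (act S s) - act S (covCSec cov X s))
      (fun s t ↦ ?_) (fun f s x ↦ ?_)
    · ext x
      have h1 : act S (s + t) = act S s + act S t := by ext x; simp
      simp only [ContMDiffSection.coe_add, ContMDiffSection.coe_sub, Pi.add_apply, Pi.sub_apply,
        covCSec_apply, act_apply, h1, hc.covC_add, map_add]
      abel
    · have h1 : act S (smulSec f s) = smulSec f (act S s) := by ext x; simp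
      simp only [ContMDiffSection.coe_sub, Pi.sub_apply, covCSec_apply, act_apply, h1,
        hc.covC_leibniz, map_add, map_smul, smul_sub]
      abel
  choose T hT using key
  have add : ∀ S S', T (S + S') = T S + T S' := fun S S' ↦ EndAlg.ext_sec σ fun s x ↦ by
    have h1 : act (S + S') s = act S s + act S' s := by ext x; simp
    simp only [EndAlg.add_apply, _root_.add_apply, hT, endCov, h1, hc.covC_add]
    abel
  have smul : ∀ (c : ℂ) S, T (c • S) = c • T S := fun c S ↦ EndAlg.ext_sec σ fun s x ↦ by
    have h1 : act (c • S) s = smulSec (constFun c) (act S s) := by ext x; simp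
    simp only [EndAlg.smul_apply, _root_.smul_apply, hT, endCov, h1, hc.covC_leibniz,
      CVField.lie_const, constFun_apply]
    module
  refine ⟨⟨⟨⟨T, add⟩, smul⟩, fun S S' ↦ EndAlg.ext_sec σ fun s x ↦ ?_⟩, hT⟩
  have h1 : act (S * S') s = act S (act S' s) := by ext x; simp
  have h2 := hT S (act S' s) x
  simp only [act_apply] at h2
  change (T (S * S')).1 x (s x) = (T S * S' + S * T S').1 x (s x)
  simp only [EndAlg.add_apply, _root_.add_apply, EndAlg.mul_apply, mul_apply_eq_comp, hT, h2,
    endCov, h1, map_sub]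
  abel

/-- The derivation `∇_X` of the algebra of sections of the endomorphism bundle. -/
def endDer (σ : SUStructure d F V n) (hc : IsConnection cov) (X : CVField d M) :
    Der (EndAlg d F V) := (exists_endDer σ hc X).choose

theorem endDer_apply (σ : SUStructure d F V n) (hc : IsConnection cov) (X : CVField d M)
    (S : EndAlg d F V) (s : Sec d F V) (x : M) :
    ((endDer σ hc X).1 S).1 x (s x) = endCov cov X S s x := (exists_endDer σ hc X).choose_spec S s x

theorem endDer_add (σ : SUStructure d F V n) (hc : IsConnection cov) (X Y : CVField d M) :
    endDer σ hc (X.add Y) = endDer σ hc X + endDer σ hc Y := Der.ext_sec σ fun S s x ↦ by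
  simp only [Der.add_apply, EndAlg.add_apply, _root_.add_apply, endDer_apply, endCov,
    hc.covC_add_field, map_add]
  abel

theorem endDer_smul (σ : SUStructure d F V n) (hc : IsConnection cov) (f : CFun d M)
    (X : CVField d M) : endDer σ hc (X.smul f) =
      (⟨scalar f, scalar_mem_center f⟩ : Subalgebra.center ℂ (EndAlg d F V)) • endDer σ hc X :=
  Der.ext_sec σ fun S s x ↦ by
    simp only [Der.smul_apply, EndAlg.mul_apply, mul_apply_eq_comp, endDer_apply, endCov,
      hc.covC_smul_field, map_smul, scalar_apply, _root_.smul_apply, ContinuousLinearMap.id_apply,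
      smul_sub]

theorem endDer_scalar (σ : SUStructure d F V n) (hc : IsConnection cov) (X : CVField d M) :
    IsFieldOf (endDer σ hc X) X := fun f x ↦ by
  ext v
  obtain ⟨s, rfl⟩ := exists_sec σ v
  have h1 : act (scalar f) s = smulSec f s := by ext x; simp
  simp only [endDer_apply, endCov, h1, hc.covC_leibniz, scalar_apply, _root_.smul_apply,
    ContinuousLinearMap.id_apply]
  abel

theorem IsFieldOf.sub_ad {D : Der (EndAlg d F V)} {X : CVField d M} (h : IsFieldOf D X)
    (a : EndAlg d F V) : IsFieldOf (D - ad a) X := fun f x ↦ by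
  rw [Der.sub_apply, ad_apply, scalar_commute, sub_self, sub_zero, h f x]

theorem IsFieldOf.unique (σ : SUStructure d F V n) {D : Der (EndAlg d F V)} {X Y : CVField d M}
    (hX : IsFieldOf D X) (hY : IsFieldOf D Y) : X = Y := CVField.ext_lie fun f x ↦ by
  have := nontrivial_fiber σ x
  obtain ⟨v, hv⟩ := exists_ne (0 : V x)
  have h := congrArg (fun L : V x →L[ℂ] V x ↦ L v) ((hX f x).symm.trans (hY f x))
  exact smul_left_injective ℂ hv h

/-- Every derivation has a vector field. -/
theorem exists_isFieldOf (σ : SUStructure d F V n) (D : Der (EndAlg d F V)) :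
    ∃ X : CVField d M, IsFieldOf D X := by
  -- A derivation preserves the center: apply it to `scalar f * S = S * scalar f`.
  have key : ∀ f : CFun d M, ∃ g : CFun d M, D.1 (scalar f) = scalar g := fun f ↦ by
    refine exists_eq_scalar σ fun S ↦ ?_
    have h1 := Der.leibniz D (scalar f) S
    rw [scalar_commute, Der.leibniz, scalar_commute, add_comm] at h1
    exact (add_right_cancel h1).symm
  choose δ hδ using key
  have inj := scalar_injective (d := d) σ
  obtain ⟨X, hX⟩ := exists_field (d := d) (M := M) (δ := δ) fun x ↦
    { add := fun f g ↦ by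
        have : δ (f + g) = δ f + δ g := inj (by rw [← hδ, scalar_add, map_add, hδ, hδ, scalar_add])
        rw [this]; rfl
      mul := fun f g ↦ by
        have : δ (f * g) = δ f * g + f * δ g := inj (by
          rw [← hδ, scalar_mul, Der.leibniz, hδ, hδ, scalar_add, scalar_mul, scalar_mul])
        rw [this]; rfl
      const := fun c ↦ by
        have h0 : (scalar (constFun c) : EndAlg d F V) = c • 1 := EndAlg.ext fun x ↦ rfl
        have : δ (constFun c) = constFun 0 := inj (by
          rw [← hδ, h0, map_smul, Der.map_one, smul_zero]
          exact EndAlg.ext fun x ↦ (zero_smul ℂ _).symm)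
        rw [this]; rfl }
  exact ⟨X, fun f x ↦ by rw [hX, hδ, scalar_apply]⟩

/-- The decomposition of a derivation defined by a connection. -/
structure IsDecomp (σ : SUStructure d F V n) (hc : IsConnection cov) (D : Der (EndAlg d F V))
    (X : CVField d M) (a : EndAlg d F V) : Prop where
  eq : D = endDer σ hc X - ad a
  tr_eq : ∀ x, tr a x = 0

theorem IsDecomp.isFieldOf {σ : SUStructure d F V n} {hc : IsConnection cov}
    {D : Der (EndAlg d F V)} {X : CVField d M} {a : EndAlg d F V} (h : IsDecomp σ hc D X a) :
    IsFieldOf D X := by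
  rw [h.eq]
  exact (endDer_scalar σ hc X).sub_ad a

theorem tr_add (a b : EndAlg d F V) (x : M) : tr (a + b) x = tr a x + tr b x := by
  simp only [tr, EndAlg.add_apply, ContinuousLinearMap.toLinearMap_add, map_add]

theorem tr_neg (a : EndAlg d F V) (x : M) : tr (-a) x = -tr a x := by
  simp only [tr, EndAlg.neg_apply, ContinuousLinearMap.toLinearMap_neg, map_neg]

theorem tr_scalar_mul (f : CFun d M) (a : EndAlg d F V) (x : M) :
    tr (scalar f * a) x = f x * tr a x := by
  have h : (scalar f * a).1 x = f x • a.1 x := by ext v; simp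
  simp only [tr, h, ContinuousLinearMap.toLinearMap_smul, map_smul, smul_eq_mul]

theorem ad_injective (σ : SUStructure d F V n) {a b : EndAlg d F V} (ha : ∀ x, tr a x = 0)
    (hb : ∀ x, tr b x = 0) (h : ad a = ad b) : a = b :=
  EndAlg.ext fun x ↦ eq_of_commutator_eq σ (ha x) (hb x) fun S ↦
    congrArg (fun D : Der (EndAlg d F V) ↦ (D.1 S).1 x) h

/-- The field is read off from the action on functions, then `a` from `ad a` and its zero trace. -/
theorem IsDecomp.unique {σ : SUStructure d F V n} {hc : IsConnection cov}
    {D : Der (EndAlg d F V)} {X Y : CVField d M} {a b : EndAlg d F V} (h : IsDecomp σ hc D X a)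
    (h' : IsDecomp σ hc D Y b) : a = b := by
  obtain rfl := h.isFieldOf.unique σ h'.isFieldOf
  exact ad_injective σ h.tr_eq h'.tr_eq (sub_right_injective (h.eq.symm.trans h'.eq))

/-- Subtracting `∇_X` leaves a derivation that kills functions, hence is linear over them, and
`exists_inner` applies. -/
theorem exists_isDecomp (σ : SUStructure d F V n) (hc : IsConnection cov)
    (D : Der (EndAlg d F V)) : ∃ a X, IsDecomp σ hc D X a := by
  obtain ⟨X, hX⟩ := exists_isFieldOf σ D
  let D' := D - endDer σ hc X
  obtain ⟨a, ha1, ha2⟩ := exists_inner σ D'.1.toAddMonoidHom (Der.leibniz D') fun f S ↦ by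
    have h0 : D'.1 (scalar f) = 0 := EndAlg.ext fun x ↦ by
      rw [Der.sub_apply, EndAlg.sub_apply, hX f x, endDer_scalar σ hc X f x, sub_self]; rfl
    refine (Der.leibniz D' _ _).trans ?_
    rw [h0, zero_mul, zero_add]
    rfl
  refine ⟨-a, X, Der.ext fun S ↦ ?_, fun x ↦ by rw [tr_neg, ha1, neg_zero]⟩
  have h1 : D.1 S - (endDer σ hc X).1 S = a * S - S * a := ha2 S
  rw [Der.sub_apply, ad_apply, sub_eq_iff_eq_add.1 h1]
  noncomm_ring

theorem ad_add {A : Type*} [Ring A] [Algebra ℂ A] (a b : A) : ad (a + b) = ad a + ad b :=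
  Der.ext fun S ↦ by rw [Der.add_apply, ad_apply, ad_apply, ad_apply]; noncomm_ring

theorem ad_smul {A : Type*} [Ring A] [Algebra ℂ A] (z : Subalgebra.center ℂ A) (a : A) :
    ad (z • a) = z • ad a := Der.ext fun S ↦ by
  have hz : z.1 * S = S * z.1 := (Subalgebra.mem_center_iff.1 z.2 S).symm
  rw [Der.smul_apply, ad_apply, ad_apply, Subalgebra.smul_def, smul_eq_mul, mul_sub, ← mul_assoc,
    ← mul_assoc, ← mul_assoc, hz]

/-- The noncommutative one-form of a connection. -/
def connForm (σ : SUStructure d F V n) (hc : IsConnection cov) : NCForm (EndAlg d F V) where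
  toFun D := (exists_isDecomp σ hc D).choose
  map_add' D D' := by
    obtain ⟨X, hX⟩ := (exists_isDecomp σ hc D).choose_spec
    obtain ⟨Y, hY⟩ := (exists_isDecomp σ hc D').choose_spec
    obtain ⟨Z, hZ⟩ := (exists_isDecomp σ hc (D + D')).choose_spec
    -- The sum of the decompositions of `D` and `D'` decomposes `D + D'`, so uniqueness gives
    -- additivity; multiples by central elements, which are functions, go the same way.
    refine hZ.unique (Y := X.add Y) ⟨?_, fun x ↦ by rw [tr_add, hX.tr_eq, hY.tr_eq, add_zero]⟩
    conv_lhs => rw [hX.eq, hY.eq]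
    rw [endDer_add, ad_add]
    abel
  map_smul' z D := by
    obtain ⟨X, hX⟩ := (exists_isDecomp σ hc D).choose_spec
    obtain ⟨Z, hZ⟩ := (exists_isDecomp σ hc (z • D)).choose_spec
    obtain ⟨f, hf⟩ := exists_eq_scalar σ fun S ↦ (Subalgebra.mem_center_iff.1 z.2 S).symm
    obtain rfl : z = ⟨scalar f, scalar_mem_center f⟩ := Subtype.ext hf
    refine hZ.unique (Y := X.smul f) ⟨?_, fun x ↦ ?_⟩
    · conv_lhs => rw [hX.eq]
      rw [endDer_smul, RingHom.id_apply, ad_smul]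
      exact Der.smul_sub _ _ _
    · exact (tr_scalar_mul f _ x).trans (by rw [hX.tr_eq, mul_zero])

theorem connForm_spec (σ : SUStructure d F V n) (hc : IsConnection cov) (D : Der (EndAlg d F V)) :
    ∃ X, IsDecomp σ hc D X (connForm σ hc D) := (exists_isDecomp σ hc D).choose_spec

theorem connForm_eq (σ : SUStructure d F V n) (hc : IsConnection cov) {D : Der (EndAlg d F V)}
    {X : CVField d M} {a : EndAlg d F V} (h : IsDecomp σ hc D X a) : connForm σ hc D = a :=
  (connForm_spec σ hc D).choose_spec.unique h

/-- That `X` is the field of `D` is automatic: inner derivations kill functions and `∇_X` has field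
`X`. -/
theorem isFormOf_iff (σ : SUStructure d F V n) (hc : IsConnection cov)
    (α : NCForm (EndAlg d F V)) :
    IsFormOf cov α ↔ ∀ D, ∃ X, D = endDer σ hc X - ad (α D) := by
  refine forall_congr' fun D ↦ exists_congr fun X ↦ ⟨fun h ↦ Der.ext_sec σ fun S s x ↦ ?_,
    fun h ↦ ⟨?_, fun S s x ↦ ?_⟩⟩
  · rw [h.2 S s x, Der.sub_apply, EndAlg.sub_apply, _root_.sub_apply, endDer_apply]
  · rw [h]
    exact (endDer_scalar σ hc X).sub_ad _
  · conv_lhs => rw [h]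
    rw [Der.sub_apply, EndAlg.sub_apply, _root_.sub_apply, endDer_apply]

theorem isFormOf_connForm (σ : SUStructure d F V n) (hc : IsConnection cov) :
    IsFormOf cov (connForm σ hc) :=
  (isFormOf_iff σ hc _).2 fun D ↦ (connForm_spec σ hc D).imp fun _ h ↦ h.eq

theorem eq_connForm (σ : SUStructure d F V n) (hc : IsConnection cov)
    {α : NCForm (EndAlg d F V)} (h1 : ∀ D x, tr (α D) x = 0) (h2 : IsFormOf cov α) :
    α = connForm σ hc := LinearMap.ext fun D ↦ by
  obtain ⟨X, hX⟩ := (isFormOf_iff σ hc α).1 h2 D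
  exact (connForm_eq σ hc ⟨hX, h1 D⟩).symm

end Connection

/-! ### Existence of `SU(n)`-connections -/

theorem contMDiff_lieD (X : VField d M) (f : CFun d M) :
    ContMDiff (𝓡 d) 𝓘(ℝ, ℂ) ∞ (lieD X f) := by
  have h1 : ContMDiff (𝓡 d).tangent 𝓘(ℝ, ℂ).tangent ∞ (tangentMap (𝓡 d) 𝓘(ℝ, ℂ) f) :=
    f.contMDiff.contMDiff_tangentMap (m := ∞) (by simp)
  have h2 : ContMDiff 𝓘(ℝ, ℂ).tangent 𝓘(ℝ, ℂ) ∞ fun p : TangentBundle 𝓘(ℝ, ℂ) ℂ ↦ p.2 :=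
    contMDiff_snd_tangentBundle_modelSpace ℂ 𝓘(ℝ, ℂ)
  exact (h2.comp h1).comp X.contMDiff

/-- The smooth function `X f`. -/
def lieFun (X : VField d M) (f : CFun d M) : CFun d M := ⟨lieD X f, contMDiff_lieD X f⟩

/-- The covariant derivative for which the sections `t i` are parallel if they form an orthonormal
frame. -/
def frameCov (σ : SUStructure d F V n) (t : Fin n → Sec d F V) (X : VField d M) (s : Sec d F V) :
    Sec d F V := ∑ i, smulSec (lieFun X (innerFun σ (t i) s)) (t i)

theorem frameCov_apply (σ : SUStructure d F V n) (t : Fin n → Sec d F V) (X : VField d M)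
    (s : Sec d F V) (x : M) :
    frameCov σ t X s x = ∑ i, ptD (X x) (innerFun σ (t i) s) • t i x := by
  rw [frameCov, Sec.sum_apply]
  rfl

theorem ptD_prod {x : M} (v : TangentSpace (𝓡 d) x) {f : Fin n → M → ℂ}
    (hf : ∀ i, MDifferentiableAt (𝓡 d) 𝓘(ℝ, ℂ) (f i) x) :
    ptD v (fun y ↦ ∏ i, f i y) =
      ∑ k, ∏ i, if i = k then ptD v (f k) else f i x := by
  have h := (HasMFDerivAt.prod (t := Finset.univ) fun i _ ↦ (hf i).hasMFDerivAt).mfderiv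
  have e : (fun y ↦ ∏ i, f i y) = ∏ i, f i := by ext y; simp
  rw [e]
  have h2 : ptD v (∏ i, f i) = ∑ i, (∏ j ∈ Finset.univ.erase i, f j x) * ptD v (f i) := by
    refine (congrArg (fun L : TangentSpace (𝓡 d) x →L[ℝ] ℂ ↦ L v) h).trans ?_
    exact _root_.sum_apply (F := EuclideanSpace ℝ (Fin d) →L[ℝ] ℂ) _ _ _
  rw [h2]
  refine Finset.sum_congr rfl fun k _ ↦ ?_
  rw [← Finset.mul_prod_erase Finset.univ _ (Finset.mem_univ k), if_pos rfl, mul_comm]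
  congr 1
  exact Finset.prod_congr rfl fun i hi ↦ (if_neg (Finset.ne_of_mem_erase hi)).symm

theorem ptD_const_mul {x : M} (v : TangentSpace (𝓡 d) x) (c : ℂ) {f : M → ℂ}
    (hf : MDifferentiableAt (𝓡 d) 𝓘(ℝ, ℂ) f x) : ptD v (fun y ↦ c * f y) = c * ptD v f := by
  rw [ptD_mul v mdifferentiableAt_const hf, ptD_const, zero_mul, zero_add]

theorem mdiffAt_prod {x : M} {f : Fin n → M → ℂ}
    (hf : ∀ i, MDifferentiableAt (𝓡 d) 𝓘(ℝ, ℂ) (f i) x) :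
    MDifferentiableAt (𝓡 d) 𝓘(ℝ, ℂ) (fun y ↦ ∏ i, f i y) x := by
  have e : (fun y ↦ ∏ i, f i y) = ∏ i, f i := by ext y; simp
  rw [e]
  exact MDifferentiableAt.prod fun i _ ↦ hf i

open Matrix in
theorem ptD_det {x : M} (v : TangentSpace (𝓡 d) x) {f : Fin n → Fin n → M → ℂ}
    (hf : ∀ i j, MDifferentiableAt (𝓡 d) 𝓘(ℝ, ℂ) (f i j) x) :
    ptD v (fun y ↦ (of fun i j ↦ f i j y).det) =
      ∑ k, ((of fun i j ↦ f i j x).updateCol k fun i ↦ ptD v (f i k)).det := by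
  simp only [det_apply', of_apply]
  rw [(ptD_sum v Finset.univ (f := fun τ y ↦ ((Equiv.Perm.sign τ : ℤ) : ℂ) * ∏ i, f (τ i) i y)
    fun τ ↦ mdifferentiableAt_const.mul (mdiffAt_prod fun i ↦ hf (τ i) i)).2, Finset.sum_comm]
  refine Finset.sum_congr rfl fun τ _ ↦ ?_
  rw [ptD_const_mul v _ (mdiffAt_prod fun i ↦ hf (τ i) i), ptD_prod v fun i ↦ hf (τ i) i,
    Finset.mul_sum]
  refine Finset.sum_congr rfl fun k _ ↦ ?_
  congr 1
  refine Finset.prod_congr rfl fun i _ ↦ ?_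
  rw [updateCol_apply]
  split_ifs with h
  · rw [h]
  · rfl

theorem IsFrameAt.vol_apply {σ : SUStructure d F V n} {t : Fin n → Sec d F V} {x : M}
    (h : IsFrameAt σ t x) (w : Fin n → V x) :
    σ.vol x w = (Matrix.of fun i j ↦ (inner ℂ (t i x) (w j) : ℂ)).det := by
  have h1 := (σ.vol x).eq_smul_basis_det h.basis.toBasis
  have h2 : σ.vol x h.basis.toBasis = 1 := by
    have h3 : (h.basis.toBasis : Fin n → V x) = fun i ↦ t i x :=
      funext fun i ↦ by rw [OrthonormalBasis.coe_toBasis, h.basis_apply]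
    rw [h3, h.vol_eq]
  rw [h1, h2, one_smul, Module.Basis.det_apply]
  congr 1
  ext i j
  simp [Module.Basis.toMatrix_apply, OrthonormalBasis.repr_apply_apply, h.basis_apply]

/-- The conditions on an `SU(n)`-connection at a point. -/
structure IsSUAt (σ : SUStructure d F V n) (x : M) (T : VField d M → Sec d F V → V x) :
    Prop where
  add_field : ∀ X Y s, T (X + Y) s = T X s + T Y s
  smul_field : ∀ (f : C^∞⟮𝓡 d, M; 𝓘(ℝ, ℝ), ℝ⟯) X s, T (smulField f X) s = f x • T X s
  add_sec : ∀ X s t, T X (s + t) = T X s + T X t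
  leibniz : ∀ X (f : CFun d M) s, T X (smulSec f s) = lieD X f x • s x + f x • T X s
  metric : ∀ X (s t : Sec d F V), lieD X (fun y ↦ (inner ℂ (s y) (t y) : ℂ)) x =
    inner ℂ (T X s) (t x) + inner ℂ (s x) (T X t)
  volume : ∀ X (s : Fin n → Sec d F V), lieD X (fun y ↦ σ.vol y fun i ↦ s i y) x =
    ∑ i, σ.vol x (Function.update (fun j ↦ s j x) i (T X (s i)))

theorem isSUConnection_of_isSUAt {σ : SUStructure d F V n}
    {cov : VField d M → Sec d F V → Sec d F V} (h : ∀ x, IsSUAt σ x fun X s ↦ cov X s x) :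
    IsSUConnection σ cov where
  add_field X Y s := ContMDiffSection.ext fun x ↦ (h x).add_field X Y s
  smul_field f X s x := (h x).smul_field f X s
  add_sec X s t := ContMDiffSection.ext fun x ↦ (h x).add_sec X s t
  leibniz X f s x := (h x).leibniz X f s
  metric X s t x := (h x).metric X s t
  volume X s x := (h x).volume X s

/-- In the coefficients `⟨t i, s⟩` the hermitian structure is the standard one and the volume is a
determinant, so the conditions reduce to product rules. These expressions get differentiated, so `t`
must be a frame on a neighbourhood. -/
theorem isSUAt_frameCov {σ : SUStructure d F V n} {t : Fin n → Sec d F V} {x : M}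
    (h : ∀ᶠ y in nhds x, IsFrameAt σ t y) : IsSUAt σ x fun X s ↦ frameCov σ t X s x := by
  have hx := h.self_of_nhds
  have md : ∀ f : CFun d M, MDifferentiableAt (𝓡 d) 𝓘(ℝ, ℂ) f x := fun f ↦ mdiffAt f.contMDiff x
  have hin : ∀ X i s, (inner ℂ (t i x) (frameCov σ t X s x) : ℂ) =
      ptD (X x) (innerFun σ (t i) s) := fun X i s ↦ by
    rw [frameCov_apply, inner_sum]
    simp [inner_smul_right, hx.inner_eq]
  refine ⟨fun X Y s ↦ ?_, fun f X s ↦ ?_, fun X s s' ↦ ?_, fun X f s ↦ ?_, fun X s s' ↦ ?_,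
    fun X s ↦ ?_⟩
  · simp only [frameCov_apply, ContMDiffSection.coe_add, Pi.add_apply, ptD_add_vec, add_smul,
      Finset.sum_add_distrib]
  · have hr : ∀ (r : ℝ) (v : V x), r • v = (r : ℂ) • v := fun _ _ ↦ rfl
    have hs : smulField f X x = f x • X x := rfl
    simp only [frameCov_apply, hs, ptD_smul_vec, mul_smul, hr, Finset.smul_sum]
  · have h1 : ∀ i, innerFun σ (t i) (s + s') = innerFun σ (t i) s + innerFun σ (t i) s' := by
      intro i; ext y; simp
    simp only [frameCov_apply, h1, ContMDiffMap.coe_add]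
    simp only [Pi.add_def, ptD_add _ (md _) (md _), add_smul, Finset.sum_add_distrib]
  · have h1 : ∀ i, innerFun σ (t i) (smulSec f s) = f * innerFun σ (t i) s := by
      intro i; ext y; simp
    have h2 : ∀ i, ptD (X x) (f * innerFun σ (t i) s : CFun d M) =
        ptD (X x) f * innerFun σ (t i) s x + f x * ptD (X x) (innerFun σ (t i) s) :=
      fun i ↦ ptD_mul _ (md _) (md _)
    simp only [frameCov_apply, h1, h2, add_smul, Finset.sum_add_distrib, mul_smul,
      ← Finset.smul_sum, innerFun_apply, hx.sum_eq]
    rfl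
  · have h1 : (fun y ↦ (inner ℂ (s y) (s' y) : ℂ)) =ᶠ[nhds x] fun y ↦ ∑ i,
        conjFun (innerFun σ (t i) s) y * innerFun σ (t i) s' y := by
      filter_upwards [h] with y hy
      conv_lhs => rw [← hy.sum_eq (s y)]
      simp only [sum_inner, inner_smul_left]
      rfl
    rw [lieD_eq, ptD_congr _ h1, (ptD_sum _ _
      (f := fun i y ↦ conjFun (innerFun σ (t i) s) y * innerFun σ (t i) s' y)
      fun i ↦ (md _).mul (md _)).2]
    simp only [ptD_mul _ (md _) (md _), Finset.sum_add_distrib]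
    have h2 : ∀ i, ptD (X x) (conjFun (innerFun σ (t i) s)) =
        star (ptD (X x) (innerFun σ (t i) s)) := fun i ↦ ptD_star _ (md _)
    congr 1
    · simp [h2, frameCov_apply]
      exact Finset.sum_congr rfl fun i _ ↦ mul_comm _ _
    · conv_rhs => rw [← hx.sum_eq (s x)]
      simp [hin]
      exact Finset.sum_congr rfl fun i _ ↦ mul_comm _ _
  · have h1 : (fun y ↦ σ.vol y fun i ↦ s i y) =ᶠ[nhds x] fun y ↦
        (Matrix.of fun i j ↦ innerFun σ (t i) (s j) y).det := by
      filter_upwards [h] with y hy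
      exact hy.vol_apply _
    rw [lieD_eq, ptD_congr _ h1, ptD_det _ fun i j ↦ md _]
    refine Finset.sum_congr rfl fun k _ ↦ ?_
    rw [hx.vol_apply]
    congr 1
    ext i j
    rw [Matrix.updateCol_apply, Matrix.of_apply, Matrix.of_apply]
    split_ifs with hjk
    · rw [hjk, Function.update_self, hin]
    · rw [Function.update_of_ne hjk]; rfl

/-- Affine combinations of connections at a point. -/
theorem IsSUAt.sum {σ : SUStructure d F V n} {x : M} {ι : Type*} (I : Finset ι) (ρ : ι → ℝ)
    (hρ : ∑ i ∈ I, ρ i = 1) {T : ι → VField d M → Sec d F V → V x}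
    (hT : ∀ i ∈ I, IsSUAt σ x (T i)) : IsSUAt σ x fun X s ↦ ∑ i ∈ I, (ρ i : ℂ) • T i X s := by
  have hρ' : ∑ i ∈ I, (ρ i : ℂ) = 1 := by exact_mod_cast hρ
  -- The derivatives of the metric and of the volume do not involve `T`; weights of sum one
  -- distribute them over the summands. Weights are real so that they leave the antilinear slot
  -- unchanged.
  have aff : ∀ (z : ℂ) (w : ι → ℂ), (∀ i ∈ I, z = w i) → z = ∑ i ∈ I, (ρ i : ℂ) * w i := by
    intro z w hw
    rw [← one_mul z, ← hρ', Finset.sum_mul]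
    exact Finset.sum_congr rfl fun i hi ↦ by rw [← hw i hi]
  refine ⟨fun X Y s ↦ ?_, fun f X s ↦ ?_, fun X s s' ↦ ?_, fun X f s ↦ ?_, fun X s s' ↦ ?_,
    fun X s ↦ ?_⟩
  · rw [← Finset.sum_add_distrib]
    exact Finset.sum_congr rfl fun i hi ↦ by rw [(hT i hi).add_field, smul_add]
  · rw [Finset.smul_sum]
    exact Finset.sum_congr rfl fun i hi ↦ by rw [(hT i hi).smul_field, smul_comm]
  · rw [← Finset.sum_add_distrib]
    exact Finset.sum_congr rfl fun i hi ↦ by rw [(hT i hi).add_sec, smul_add]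
  · have : lieD X f x • s x = ∑ i ∈ I, (ρ i : ℂ) • lieD X f x • s x := by
      rw [← Finset.sum_smul, hρ', one_smul]
    rw [this, Finset.smul_sum, ← Finset.sum_add_distrib]
    exact Finset.sum_congr rfl fun i hi ↦ by rw [(hT i hi).leibniz, smul_add, smul_comm (f x)]
  · rw [aff _ _ fun i hi ↦ (hT i hi).metric X s s']
    simp only [sum_inner, inner_sum, inner_smul_left, inner_smul_right, Complex.conj_ofReal,
      mul_add, Finset.sum_add_distrib]
  · rw [aff _ _ fun i hi ↦ (hT i hi).volume X s]
    simp only [Finset.mul_sum]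
    rw [Finset.sum_comm]
    refine Finset.sum_congr rfl fun k _ ↦ ?_
    rw [AlternatingMap.map_update_sum]
    simp only [AlternatingMap.map_update_smul, smul_eq_mul]

open Set Topology in
theorem exists_smooth_pos_of_isCompact {K U : Set M} (hK : IsCompact K) (hU : IsOpen U)
    (hKU : K ⊆ U) : ∃ g : C^∞⟮𝓡 d, M; 𝓘(ℝ, ℝ), ℝ⟯, (∀ x, 0 ≤ g x) ∧ (∀ x ∈ K, 0 < g x) ∧
      Function.support g ⊆ U := by
  have h : ∀ x : M, ∃ χ : C^∞⟮𝓡 d, M; 𝓘(ℝ, ℝ), ℝ⟯, x ∈ K →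
      (∀ᶠ y in 𝓝 x, 0 < χ y) ∧ Function.support χ ⊆ U ∧ ∀ x, 0 ≤ χ x := fun x ↦ by
    by_cases hx : x ∈ K
    · obtain ⟨χ, h1, h2, -, h3⟩ := exists_cutoff (d := d) (hU.mem_nhds (hKU hx))
      refine ⟨χ, fun _ ↦ ⟨?_, (subset_tsupport _).trans h2, h3⟩⟩
      filter_upwards [h1] with y hy
      rw [hy]
      exact one_pos
    · exact ⟨0, fun h ↦ absurd h hx⟩
  choose χ hχ using h
  obtain ⟨I, hI, hcov⟩ := hK.elim_nhds_subcover (fun x ↦ {y | x ∈ K → 0 < χ x y}) fun x hx ↦ by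
    filter_upwards [(hχ x hx).1] with y hy _ using hy
  refine ⟨⟨fun y ↦ ∑ x ∈ I, χ x y, contMDiff_finsetSum fun x _ ↦ (χ x).contMDiff⟩,
    fun y ↦ Finset.sum_nonneg fun x hx ↦ (hχ x (hI x hx)).2.2 y, fun y hy ↦ ?_, fun y hy ↦ ?_⟩
  · obtain ⟨x, hx, hxy⟩ := mem_iUnion₂.1 (hcov hy)
    exact Finset.sum_pos' (fun x hx ↦ (hχ x (hI x hx)).2.2 y) ⟨x, hx, hxy (hI x hx)⟩
  · obtain ⟨x, hx, hxy⟩ := Finset.exists_ne_zero_of_sum_ne_zero hy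
    exact (hχ x (hI x hx)).2.1 hxy

open Set Topology in
/-- Smooth partitions of unity on a paracompact manifold. -/
theorem exists_partition [ParacompactSpace M] (N : M → Set M) (hN : ∀ x, N x ∈ 𝓝 x) :
    ∃ ρ : M → C^∞⟮𝓡 d, M; 𝓘(ℝ, ℝ), ℝ⟯, (LocallyFinite fun x ↦ Function.support (ρ x)) ∧
      (∀ y, ∑ᶠ x, ρ x y = 1) ∧ ∀ x y, ρ x y ≠ 0 → y ∈ N x := by
  have : LocallyCompactSpace M := ChartedSpace.locallyCompactSpace (EuclideanSpace ℝ (Fin d)) M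
  have hK : ∀ x, ∃ K, IsCompact K ∧ x ∈ interior K ∧ K ⊆ N x := fun x ↦ by
    obtain ⟨K, h1, h2, h3⟩ := local_compact_nhds (hN x)
    exact ⟨K, h3, mem_interior_iff_mem_nhds.2 h1, h2⟩
  -- A locally finite refinement `W` of the interiors of the `K x` is shrunk to `W'` with compact
  -- closures in `W`. Functions positive on these closures and supported in `W` have a positive sum,
  -- by which they are divided.
  choose K hKc hKi hKN using hK
  obtain ⟨W, hWo, hWu, hWf, hWK⟩ := precise_refinement (fun x ↦ interior (K x))
    (fun x ↦ isOpen_interior) (iUnion_eq_univ_iff.2 fun x ↦ ⟨x, hKi x⟩)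
  obtain ⟨W', hWu', -, hW'⟩ := exists_iUnion_eq_closure_subset hWo (fun x ↦ hWf.point_finite x) hWu
  have hc : ∀ x, IsCompact (closure (W' x)) := fun x ↦
    (hKc x).of_isClosed_subset isClosed_closure
      ((hW' x).trans ((hWK x).trans interior_subset))
  choose g hg0 hg1 hg2 using fun x ↦ exists_smooth_pos_of_isCompact (d := d) (hc x) (hWo x) (hW' x)
  have hlf : LocallyFinite fun x ↦ Function.support (g x) := hWf.subset hg2
  have hfin : ∀ y, (Function.support fun x ↦ g x y).Finite := fun y ↦ hlf.point_finite y
  have hG : ContMDiff (𝓡 d) 𝓘(ℝ, ℝ) ∞ fun y ↦ ∑ᶠ x, g x y :=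
    contMDiff_finsum (fun x ↦ (g x).contMDiff) hlf
  have hpos : ∀ y, 0 < ∑ᶠ x, g x y := fun y ↦ by
    obtain ⟨x, hx⟩ := iUnion_eq_univ_iff.1 hWu' y
    exact finsum_pos (fun x ↦ hg0 x y) ⟨x, hg1 x y (subset_closure hx)⟩ (hfin y)
  have hinv : ContMDiff (𝓡 d) 𝓘(ℝ, ℝ) ∞ fun y ↦ (∑ᶠ x, g x y)⁻¹ := fun y ↦
    (contDiffAt_inv ℝ (hpos y).ne').contMDiffAt.comp y (hG y)
  refine ⟨fun x ↦ g x * ⟨_, hinv⟩, hlf.subset fun x y hy ↦ left_ne_zero_of_mul hy, fun y ↦ ?_,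
    fun x y hy ↦ hKN x (interior_subset (hWK x (hg2 x (left_ne_zero_of_mul hy))))⟩
  change ∑ᶠ x, g x y * (∑ᶠ x, g x y)⁻¹ = 1
  rw [← finsum_mul' _ _ (hfin y), mul_inv_cancel₀ (hpos y).ne']

/-- Existence of `SU(n)`-connections. -/
theorem exists_isSUConnection [ParacompactSpace M] (σ : SUStructure d F V n) :
    ∃ cov : VField d M → Sec d F V → Sec d F V, IsSUConnection σ cov := by
  choose t ht using exists_frame (NeZero.pos n) Fact.out σ
  obtain ⟨ρ, h1, h2, h3⟩ := exists_partition (d := d)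
    (fun x ↦ {y | ∀ᶠ z in nhds y, IsFrameAt σ (t x) z}) fun x ↦ eventually_eventually_nhds.2 (ht x)
  let D : M → VField d M → Sec d F V → Sec d F V := fun x X s ↦
    smulSec (ofRealFun (ρ x)) (frameCov σ (t x) X s)
  have hlf : ∀ X s, LocallyFinite fun x ↦ {y | D x X s y ≠ 0} := fun X s ↦
    h1.subset fun x y hy h0 ↦ hy (by simp [D, h0])
  refine ⟨fun X s ↦ ⟨fun y ↦ ∑ᶠ x, D x X s y,
    ContMDiff.finsum_section_of_locallyFinite (hlf X s) fun x ↦ (D x X s).contMDiff⟩,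
    isSUConnection_of_isSUAt fun y ↦ ?_⟩
  have hfin : (Function.support fun x ↦ ρ x y).Finite := h1.point_finite y
  -- At a fixed point the sum is a finite affine combination of frame connections, so the conditions
  -- can be checked pointwise by `IsSUAt.sum`.
  have key : ∀ X s, ∑ᶠ x, D x X s y =
      ∑ x ∈ hfin.toFinset, (ρ x y : ℂ) • frameCov σ (t x) X s y := fun X s ↦
    finsum_eq_sum_of_support_subset _ fun x hx ↦ by
      rw [Set.Finite.coe_toFinset]
      exact fun h0 ↦ hx (by simp [D, h0])
  change IsSUAt σ y fun X s ↦ ∑ᶠ x, D x X s y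
  simp only [key]
  refine IsSUAt.sum _ _ ?_ fun x hx ↦ isSUAt_frameCov (h3 x y (by simpa using hx))
  rw [← h2 y, finsum_eq_sum_of_support_subset _ (Set.Finite.coe_toFinset hfin).ge]

/-! ### Traces, adjoints and real derivations -/

open Matrix in
/-- An endomorphism acts on a volume form by its trace. -/
theorem IsFrameAt.sum_vol {σ : SUStructure d F V n} {t : Fin n → Sec d F V} {x : M}
    (h : IsFrameAt σ t x) (B : V x →L[ℂ] V x) (w : Fin n → V x) :
    ∑ k, σ.vol x (Function.update w k (B (w k))) =
      LinearMap.trace ℂ (V x) (B : V x →ₗ[ℂ] V x) * σ.vol x w := by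
  let A : Matrix (Fin n) (Fin n) ℂ := of fun i j ↦ inner ℂ (t i x) (w j)
  let P : Matrix (Fin n) (Fin n) ℂ := of fun i j ↦ inner ℂ (t i x) (B (t j x))
  -- Cramer's rule: the summand is the determinant of `A` with column `k` replaced by that of `P *
  -- A`. Summing over `k` gives the trace of `P * (A * A.adjugate)`, that is, `P.trace * A.det`.
  have h1 : ∀ k, σ.vol x (Function.update w k (B (w k))) = (A.adjugate * (P * A)) k k := fun k ↦ by
    have h2 : (of fun i j ↦ (inner ℂ (t i x) (Function.update w k (B (w k)) j) : ℂ)) =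
        A.updateCol k fun i ↦ (P * A) i k := by
      ext i j
      rw [updateCol_apply, of_apply]
      split_ifs with hj
      · rw [hj, Function.update_self, mul_apply]
        conv_lhs => rw [← h.sum_eq (w k)]
        rw [map_sum, inner_sum]
        refine Finset.sum_congr rfl fun j _ ↦ ?_
        rw [map_smul, inner_smul_right, mul_comm]
        rfl
      · rw [Function.update_of_ne hj]; rfl
    rw [h.vol_apply, h2, ← cramer_apply, cramer_eq_adjugate_mulVec]
    rfl
  have h3 : LinearMap.trace ℂ (V x) (B : V x →ₗ[ℂ] V x) = P.trace := by
    rw [LinearMap.trace_eq_sum_inner _ h.basis]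
    simp [P, trace]
  calc _ = (A.adjugate * (P * A)).trace := Finset.sum_congr rfl fun k _ ↦ h1 k
    _ = _ := by
      rw [trace_mul_comm, Matrix.mul_assoc, mul_adjugate, Matrix.mul_smul, Matrix.mul_one,
        trace_smul, h3, h.vol_apply, smul_eq_mul, mul_comm]

/-- The fiberwise adjoint is smooth since in a local frame `S^* s = ∑ ⟨S (t i), s⟩ t i`. -/
theorem exists_isAdj (σ : SUStructure d F V n) (S : EndAlg d F V) : ∃ T, IsAdj S T := by
  have hc : ∀ x, CompleteSpace (V x) := fun x ↦
    haveI := finiteDimensional_fiber (F := F) (V := V) x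
    FiniteDimensional.complete ℂ (V x)
  refine ⟨⟨fun x ↦ ContinuousLinearMap.adjoint (S.1 x), mem_endSubalgebra fun s x ↦ ?_⟩,
    fun x v w ↦ (ContinuousLinearMap.adjoint_inner_right _ _ _).symm⟩
  obtain ⟨t, ht⟩ := exists_frame (NeZero.pos n) Fact.out σ x
  refine ContMDiffAt.congr_of_eventuallyEq
    ((∑ i, smulSec (innerFun σ (act S (t i)) s) (t i) : Sec d F V).contMDiff x) ?_
  filter_upwards [ht] with y hy
  congr 1
  rw [Sec.sum_apply, ← hy.sum_eq (ContinuousLinearMap.adjoint (S.1 y) (s y))]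
  simp [ContinuousLinearMap.adjoint_inner_right]

section Adjoint

variable {S S' T T' : EndAlg d F V}

theorem IsAdj.unique (h : IsAdj S T) (h' : IsAdj S T') : T = T' :=
  EndAlg.ext fun x ↦ ContinuousLinearMap.ext fun w ↦ ext_inner_left ℂ fun v ↦ by
    rw [← h x v w, h' x v w]

theorem IsAdj.sub (h : IsAdj S T) (h' : IsAdj S' T') : IsAdj (S - S') (T - T') := fun x v w ↦ by
  simp only [EndAlg.sub_apply, _root_.sub_apply, inner_sub_left, inner_sub_right, h x v w,
    h' x v w]

theorem IsAdj.mul (h : IsAdj S T) (h' : IsAdj S' T') : IsAdj (S * S') (T' * T) := fun x v w ↦ by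
  simp only [EndAlg.mul_apply, mul_apply_eq_comp, h x, h' x]

theorem IsAdj.symm (h : IsAdj S T) : IsAdj T S := fun x v w ↦ by
  rw [← inner_conj_symm, ← h x w v, inner_conj_symm]

theorem IsAdj.tr_eq (σ : SUStructure d F V n) (h : IsAdj S T) (x : M) : tr T x = star (tr S x) := by
  obtain ⟨t, ht⟩ := exists_frame_at σ x
  rw [ht.tr_eq, ht.tr_eq, star_sum]
  exact Finset.sum_congr rfl fun i _ ↦ by rw [← h x, ← inner_conj_symm]; rfl

theorem isAdj_scalar (f : CFun d M) :
    IsAdj (scalar f : EndAlg d F V) (scalar (conjFun f)) := fun x v w ↦ by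
  simp [mul_comm]

end Adjoint

/-- A real vector field as a complex vector field. -/
def VField.toComplex (Y : VField d M) : CVField d M := ⟨Y, 0⟩

theorem VField.toComplex_add (Y Z : VField d M) :
    VField.toComplex (Y + Z) = (VField.toComplex Y).add (VField.toComplex Z) := by
  simp [VField.toComplex, CVField.add]

theorem VField.toComplex_smul (f : C^∞⟮𝓡 d, M; 𝓘(ℝ, ℝ), ℝ⟯) (Y : VField d M) :
    VField.toComplex (smulField f Y) = (VField.toComplex Y).smul (ofRealFun f) := by
  have h0 : ∀ g : C^∞⟮𝓡 d, M; 𝓘(ℝ, ℝ), ℝ⟯, smulField g (0 : VField d M) = 0 := fun g ↦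
    ContMDiffSection.ext fun x ↦ smul_zero _
  have h1 : smulField (imFun (ofRealFun f)) Y = 0 := ContMDiffSection.ext fun x ↦ zero_smul ℝ _
  have h2 : reFun (ofRealFun f) = f := rfl
  simp [VField.toComplex, CVField.smul, h0, h1, h2]

theorem CVField.eq_add (X : CVField d M) : X = (VField.toComplex X.re).add
    ((VField.toComplex X.im).smul (constFun Complex.I)) := by
  have h0 : ∀ g : C^∞⟮𝓡 d, M; 𝓘(ℝ, ℝ), ℝ⟯, smulField g (0 : VField d M) = 0 := fun g ↦
    ContMDiffSection.ext fun x ↦ smul_zero _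
  have h1 : ∀ Y : VField d M, smulField (reFun (constFun Complex.I)) Y = 0 := fun Y ↦
    ContMDiffSection.ext fun x ↦ zero_smul ℝ _
  have h2 : ∀ Y : VField d M, smulField (imFun (constFun Complex.I)) Y = Y := fun Y ↦
    ContMDiffSection.ext fun x ↦ one_smul ℝ _
  cases X
  simp [VField.toComplex, CVField.smul, CVField.add, h0, h1, h2]

/-- The vector field of a real derivation is real. -/
theorem IsFieldOf.im_eq_zero (σ : SUStructure d F V n) {D : Der (EndAlg d F V)} {X : CVField d M}
    (h : IsFieldOf D X) (hD : IsReal D) : X.im = 0 := by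
  have key : X = ⟨X.re, -X.im⟩ := CVField.ext_lie fun f x ↦ by
    have := nontrivial_fiber σ x
    obtain ⟨v, hv⟩ := exists_ne (0 : V x)
    -- Reality of `D` on the functions says that `X f` is the conjugate of `X` applied to the
    -- conjugate of `f`, so `X` is its own conjugate.
    have h1 := hD _ _ (isAdj_scalar (conjFun f)) x v v
    have h2 : conjFun (conjFun f) = f := by ext y; simp
    rw [h2, h, h] at h1
    simp only [_root_.smul_apply, ContinuousLinearMap.id_apply, inner_smul_left,
      inner_smul_right] at h1
    have h3 := mul_right_cancel₀ (inner_self_ne_zero.2 hv) h1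
    have h4 : ∀ w : TangentSpace (𝓡 d) x, ptD w (conjFun f) = star (ptD w f) := fun w ↦
      ptD_star _ (mdiffAt f.contMDiff x)
    have h5 : lieD (-X.im) f x = -lieD X.im f x := map_neg (mfderiv (𝓡 d) 𝓘(ℝ, ℂ) f x) (X.im x)
    rw [← h3]
    simp only [CVField.lie, h5]
    rw [lieD_eq, lieD_eq, h4, h4]
    simp [lieD_eq]
  have h1 : X.im = -X.im := congrArg CVField.im key
  ext x : 1
  have h2 : X.im x = -X.im x := congrArg (fun Y : VField d M ↦ Y x) h1
  have h3 : (2 : ℝ) • X.im x = 0 := by rw [two_smul]; nth_rewrite 1 [h2]; exact neg_add_cancel _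
  exact (smul_eq_zero_iff_right (M := EuclideanSpace ℝ (Fin d)) two_ne_zero).1 h3

/-! ### The correspondence between connections and one-forms -/

section Gauge

variable {σ : SUStructure d F V n} {cov cov' : VField d M → Sec d F V → Sec d F V}

theorem IsConnection.covC_toComplex (hc : IsConnection cov) (Y : VField d M) (s : Sec d F V)
    (x : M) : covC cov (VField.toComplex Y) s x = cov Y s x := by
  simp [covC, VField.toComplex, hc.zero_field]

/-- Covariant derivatives in real directions are real derivations. -/
theorem IsSUConnection.isReal (hc : IsSUConnection σ cov) (Y : VField d M) :
    IsReal (endDer σ hc.toIsConnection (VField.toComplex Y)) := fun S T h x v w ↦ by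
  obtain ⟨s, rfl⟩ := exists_sec σ v
  obtain ⟨t, rfl⟩ := exists_sec σ w
  -- The function `⟨S s, t⟩ = ⟨s, T t⟩` is differentiated in both forms and the results compared.
  have h1 := hc.metric Y (act S s) t x
  have h2 := hc.metric Y s (act T t) x
  have h3 : (fun y ↦ (inner ℂ (act S s y) (t y) : ℂ)) = fun y ↦ inner ℂ (s y) (act T t y) :=
    funext fun y ↦ h y _ _
  rw [h3, h2] at h1
  rw [endDer_apply, endDer_apply, endCov, endCov, inner_sub_left, inner_sub_right]
  simp only [hc.covC_toComplex]
  rw [h x, ← h x]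
  simp only [act_apply, h x] at h1 ⊢
  linear_combination -h1

/-- Since `D` and `∇_Y` are real, so is `ad a`; this means that `a + a^*` commutes with everything,
and a traceless central element is zero. -/
theorem IsSUConnection.isAdj_connForm (hc : IsSUConnection σ cov) {D : Der (EndAlg d F V)}
    (hD : IsReal D) :
    IsAdj (connForm σ hc.toIsConnection D) (-connForm σ hc.toIsConnection D) := by
  obtain ⟨X, hX⟩ := connForm_spec σ hc.toIsConnection D
  set a := connForm σ hc.toIsConnection D
  obtain ⟨a', ha⟩ := exists_isAdj σ a
  obtain ⟨Y, rfl⟩ : ∃ Y, X = VField.toComplex Y := by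
    obtain ⟨Y, Z⟩ := X
    obtain rfl : Z = 0 := hX.isFieldOf.im_eq_zero σ hD
    exact ⟨Y, rfl⟩
  have h0 : a + a' = 0 := by
    refine eq_zero_of_commute_of_tr σ (fun T ↦ ?_) fun x ↦ ?_
    · obtain ⟨S, hS⟩ := exists_isAdj σ T
      replace hS := hS.symm
      have e : ∀ S, D.1 S = (endDer σ hc.toIsConnection (VField.toComplex Y)).1 S -
        (a * S - S * a) := fun S ↦ congrArg (fun D : Der (EndAlg d F V) ↦ D.1 S) hX.eq
      have h1 := hD S T hS
      rw [e] at h1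
      have h2 := h1.unique ((hc.isReal Y S T hS).sub ((ha.mul hS).sub (hS.mul ha)))
      rw [e T, sub_right_inj] at h2
      rw [add_mul, mul_add, ← sub_eq_zero]
      have h3 := sub_eq_zero.2 h2
      rw [← h3]
      abel
    · rw [tr_add, ha.tr_eq σ, hX.tr_eq, star_zero, add_zero]
  rwa [← neg_eq_of_add_eq_zero_right h0] at ha

theorem IsSUConnection.connForm_mem (hc : IsSUConnection σ cov) :
    connForm σ hc.toIsConnection ∈ gaugeForms d F V := by
  refine ⟨fun D x ↦ ?_, fun D hD ↦ hc.isAdj_connForm hD, fun γ hγ ↦ ?_⟩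
  · obtain ⟨X, hX⟩ := connForm_spec σ hc.toIsConnection D
    exact hX.tr_eq x
  -- The decomposition of `ad γ` is `∇_0 - ad (-γ)`.
  · refine connForm_eq σ hc.toIsConnection (X := VField.toComplex 0)
      ⟨Der.ext_sec σ fun S s x ↦ ?_, fun x ↦ by rw [tr_neg, hγ, neg_zero]⟩
    rw [Der.sub_apply, EndAlg.sub_apply, _root_.sub_apply, endDer_apply, endCov,
      hc.covC_toComplex, hc.covC_toComplex, hc.zero_field, hc.zero_field, ad_apply, ad_apply]
    simp
    abel

/-- A connection is determined by its noncommutative one-form. -/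
theorem IsSUConnection.eq_of_connForm_eq (hc : IsSUConnection σ cov)
    (hc' : IsSUConnection σ cov')
    (h : connForm σ hc.toIsConnection = connForm σ hc'.toIsConnection) : cov = cov' := by
  funext Y s
  let D := endDer σ hc.toIsConnection (VField.toComplex Y)
  -- `∇_Y` is its own decomposition, with generator zero. The other connection has the same form, so
  -- both induce the same derivation along `Y`.
  have h0 : connForm σ hc.toIsConnection D = 0 := by
    refine connForm_eq σ hc.toIsConnection (X := VField.toComplex Y) ⟨Der.ext fun S ↦ ?_,
      fun x ↦ map_zero (LinearMap.trace ℂ (V x))⟩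
    rw [Der.sub_apply, ad_apply, zero_mul, mul_zero, sub_self, sub_zero]
  obtain ⟨X, hX⟩ := connForm_spec σ hc'.toIsConnection D
  obtain rfl : X = VField.toComplex Y :=
    hX.isFieldOf.unique σ (endDer_scalar σ hc.toIsConnection _)
  rw [← h, h0] at hX
  obtain ⟨B, hB⟩ := exists_endo σ (fun s ↦ cov Y s - cov' Y s)
    (fun s t ↦ by rw [hc.add_sec, hc'.add_sec]; abel)
    (fun f s x ↦ by
      simp only [ContMDiffSection.coe_sub, Pi.sub_apply, hc.leibniz, hc'.leibniz, smul_sub]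
      abel)
  simp only [ContMDiffSection.coe_sub, Pi.sub_apply] at hB
  -- The difference `B` acts trivially on `End E`, hence is central; its trace vanishes by `sum_vol`
  -- because both connections preserve the volume.
  have hB0 : B = 0 := by
    refine eq_zero_of_commute_of_tr σ (fun S ↦ EndAlg.ext_sec σ fun s x ↦ ?_) fun x ↦ ?_
    · have h1 := congrArg (fun D : Der (EndAlg d F V) ↦ (D.1 S).1 x (s x)) hX.eq
      simp only [D, Der.sub_apply, endDer_apply, endCov,
        hc.covC_toComplex, hc'.covC_toComplex, ad_apply, zero_mul, mul_zero, sub_self, sub_zero]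
        at h1
      have h2 := hB (act S s) x
      rw [act_apply] at h2
      rw [EndAlg.mul_apply, EndAlg.mul_apply, mul_apply_eq_comp, mul_apply_eq_comp, h2, hB, map_sub]
      rw [sub_eq_sub_iff_sub_eq_sub]
      simpa using h1
    · obtain ⟨t, ht⟩ := exists_frame_at σ x
      have h1 := ht.sum_vol (B.1 x) fun i ↦ t i x
      have h2 := hc.volume Y t x
      rw [hc'.volume Y t x] at h2
      simp only [hB, AlternatingMap.map_update_sub, Finset.sum_sub_distrib, ← h2, sub_self,
        ht.vol_eq, mul_one] at h1
      exact h1.symm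
  ext x
  have h3 := hB s x
  rw [hB0] at h3
  exact (sub_eq_zero.1 h3.symm)

/-- The connection obtained by adding a noncommutative one-form to a reference connection. -/
def addForm (σ : SUStructure d F V n) (hc : IsConnection cov) (α : NCForm (EndAlg d F V))
    (Y : VField d M) (s : Sec d F V) : Sec d F V :=
  cov Y s + act (α (endDer σ hc (VField.toComplex Y))) s

theorem addForm_apply (hc : IsConnection cov) (α : NCForm (EndAlg d F V)) (Y : VField d M)
    (s : Sec d F V) (x : M) : addForm σ hc α Y s x =
      cov Y s x + (α (endDer σ hc (VField.toComplex Y))).1 x (s x) := rfl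

theorem form_endDer_smul (hc : IsConnection cov) (α : NCForm (EndAlg d F V)) (f : CFun d M)
    (X : CVField d M) : α (endDer σ hc (X.smul f)) = scalar f * α (endDer σ hc X) := by
  rw [endDer_smul]
  exact map_smul α _ _

/-- `∇_Y` is a real derivation for real `Y`, so the added term is antihermitian and keeps the metric
parallel; being traceless it keeps the volume parallel. -/
theorem isSUConnection_addForm (hc : IsSUConnection σ cov) {α : NCForm (EndAlg d F V)}
    (hα : α ∈ gaugeForms d F V) : IsSUConnection σ (addForm σ hc.toIsConnection α) where
  add_field X Y s := by
    ext x
    simp only [ContMDiffSection.coe_add, Pi.add_apply, addForm_apply, hc.add_field,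
      VField.toComplex_add, endDer_add, map_add, EndAlg.add_apply, _root_.add_apply]
    abel
  smul_field f X s x := by
    simp only [addForm_apply, VField.toComplex_smul, form_endDer_smul, hc.smul_field, smul_add,
      EndAlg.mul_apply, mul_apply_eq_comp, scalar_apply, _root_.smul_apply,
      ContinuousLinearMap.id_apply]
    rfl
  add_sec X s t := by
    ext x
    simp only [ContMDiffSection.coe_add, Pi.add_apply, addForm_apply, hc.add_sec, map_add]
    abel
  leibniz X f s x := by
    simp only [addForm_apply, hc.leibniz, smulSec_apply, map_smul, smul_add]
    abel
  metric X s t x := by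
    have h1 := hα.2.1 _ (hc.isReal X) x (s x) (t x)
    rw [EndAlg.neg_apply, _root_.neg_apply, inner_neg_right] at h1
    simp only [addForm_apply, inner_add_left, inner_add_right, hc.metric X s t x]
    linear_combination -h1
  volume X s x := by
    obtain ⟨t, ht⟩ := exists_frame_at σ x
    have h1 := ht.sum_vol ((α (endDer σ hc.toIsConnection (VField.toComplex X))).1 x)
      fun j ↦ s j x
    have h2 := hα.1 (endDer σ hc.toIsConnection (VField.toComplex X)) x
    rw [tr] at h2
    rw [h2, zero_mul] at h1
    simp only [addForm_apply, AlternatingMap.map_update_add, Finset.sum_add_distrib, h1, add_zero,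
      hc.volume X s x]

/-- `addForm` is defined along real fields; linearity of `α` over the center, which contains `i`,
extends the formula to complex ones. -/
theorem covC_addForm (hc : IsConnection cov) (α : NCForm (EndAlg d F V)) (X : CVField d M)
    (s : Sec d F V) (x : M) : covC (addForm σ hc α) X s x =
      covC cov X s x + (α (endDer σ hc X)).1 x (s x) := by
  have h : α (endDer σ hc X) = α (endDer σ hc (VField.toComplex X.re)) +
      scalar (constFun Complex.I) * α (endDer σ hc (VField.toComplex X.im)) := by
    conv_lhs => rw [X.eq_add]
    rw [endDer_add, map_add, form_endDer_smul]
  rw [h, covC, covC, addForm_apply, addForm_apply]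
  simp only [EndAlg.add_apply, EndAlg.mul_apply, mul_apply_eq_comp, scalar_apply,
    _root_.add_apply, _root_.smul_apply, ContinuousLinearMap.id_apply, constFun_apply, smul_add]
  abel

/-- Write `D = ∇_X - ad a` with the reference connection. Then `α(ad a) = -a` gives `α(D) = α(∇_X) +
a`, while the new connection induces `∇_X + ad α(∇_X)`; the extra terms cancel. -/
theorem isFormOf_addForm (hc : IsSUConnection σ cov) {α : NCForm (EndAlg d F V)}
    (hα : α ∈ gaugeForms d F V) : IsFormOf (addForm σ hc.toIsConnection α) α := by
  have hc' := isSUConnection_addForm hc hα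
  refine (isFormOf_iff σ hc'.toIsConnection α).2 fun D ↦ ?_
  obtain ⟨X, hX⟩ := connForm_spec σ hc.toIsConnection D
  refine ⟨X, ?_⟩
  set a := connForm σ hc.toIsConnection D
  have h1 : α D = α (endDer σ hc.toIsConnection X) + a := by
    conv_lhs => rw [hX.eq]
    exact (map_sub α _ _).trans (by rw [hα.2.2 a hX.tr_eq, sub_neg_eq_add])
  have h2 : endDer σ hc'.toIsConnection X =
      endDer σ hc.toIsConnection X + ad (α (endDer σ hc.toIsConnection X)) :=
    Der.ext_sec σ fun S s x ↦ by
      rw [Der.add_apply, EndAlg.add_apply, _root_.add_apply, endDer_apply, endDer_apply, endCov,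
        endCov, covC_addForm, covC_addForm, ad_apply]
      simp only [map_add, act_apply, EndAlg.sub_apply, EndAlg.mul_apply, _root_.sub_apply,
        mul_apply_eq_comp]
      abel
  rw [h1, h2, ad_add]
  exact hX.eq.trans (by abel)

/-- All three decompositions of `D` involve the same field, so they can be combined with
coefficients `c`, `-c`, `1` of sum one, which reproduces `D`. -/
theorem isFormOf_affine {p q r : VField d M → Sec d F V → Sec d F V} (hp : IsConnection p)
    (hq : IsConnection q) (hr : IsConnection r) (σ : SUStructure d F V n) (c : ℝ) :
    IsFormOf (c • (p - q) + r) (c • (connForm σ hp - connForm σ hq) + connForm σ hr) := by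
  intro D
  obtain ⟨X, hX, h1⟩ := isFormOf_connForm σ hp D
  obtain ⟨Y, hY, h2⟩ := isFormOf_connForm σ hq D
  obtain ⟨Z, hZ, h3⟩ := isFormOf_connForm σ hr D
  obtain rfl := hX.unique σ hY
  obtain rfl := hX.unique σ hZ
  refine ⟨X, hX, fun S s x ↦ ?_⟩
  have hcov : ∀ s, covC (c • (p - q) + r) X s x =
      (c : ℂ) • (covC p X s x - covC q X s x) + covC r X s x := fun s ↦ by
    have h : ∀ Y, (c • (p - q) + r) Y s x = (c : ℂ) • (p Y s x - q Y s x) + r Y s x :=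
      fun Y ↦ rfl
    rw [covC, h, h, covC, covC, covC]
    module
  have hform : ((c • (connForm σ hp - connForm σ hq) + connForm σ hr :
      NCForm (EndAlg d F V)) D).1 x =
      (c : ℂ) • ((connForm σ hp D).1 x - (connForm σ hq D).1 x) + (connForm σ hr D).1 x := rfl
  have e1 := h1 S s x
  have e2 := h2 S s x
  have e3 := h3 S s x
  rw [ad_apply, EndAlg.sub_apply, EndAlg.mul_apply, EndAlg.mul_apply] at e1 e2 e3 ⊢
  rw [hform, endCov, hcov, hcov]
  rw [endCov] at e1 e2 e3
  simp only [_root_.sub_apply, _root_.add_apply, _root_.smul_apply, mul_apply_eq_comp, map_add,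
    map_sub, map_smul] at e1 e2 e3 ⊢
  have e : ∀ u u₁ u₂ u₃ : V x, u = u₁ → u = u₂ → u = u₃ → u = (c : ℂ) • (u₁ - u₂) + u₃ := by
    rintro u _ _ _ rfl rfl rfl
    rw [sub_self, smul_zero, zero_add]
  rw [e _ _ _ _ e1 e2 e3]
  module

end Gauge

end Sections

/-- The linear part is `v ↦ f (v +ᵥ p₀) -ᵥ f p₀`: the case `c = 1` gives additivity, and `q = r =
p₀` gives homogeneity. -/
theorem exists_affineMap_of_combination {V₁ P₁ V₂ P₂ : Type*} [AddCommGroup V₁] [Module ℝ V₁]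
    [AddTorsor V₁ P₁] [AddCommGroup V₂] [Module ℝ V₂] [AddTorsor V₂ P₂] (f : P₁ → P₂)
    (hf : ∀ (c : ℝ) (p q r : P₁), f (c • (p -ᵥ q) +ᵥ r) = c • (f p -ᵥ f q) +ᵥ f r) :
    ∃ g : P₁ →ᵃ[ℝ] P₂, ⇑g = f := by
  obtain ⟨p₀⟩ : Nonempty P₁ := AddTorsor.nonempty
  refine ⟨⟨f, ⟨⟨fun v ↦ f (v +ᵥ p₀) -ᵥ f p₀, fun v w ↦ ?_⟩, fun c v ↦ ?_⟩, fun p v ↦ ?_⟩, rfl⟩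
  · have h := hf 1 (v +ᵥ p₀) p₀ (w +ᵥ p₀)
    rw [vadd_vsub, one_smul, one_smul, vadd_vadd] at h
    rw [h, vadd_vsub_assoc]
  · have h := hf c (v +ᵥ p₀) p₀ p₀
    rw [vadd_vsub] at h
    change f ((c • v) +ᵥ p₀) -ᵥ f p₀ = c • (f (v +ᵥ p₀) -ᵥ f p₀)
    rw [h, vadd_vsub]
  · have h := hf 1 (v +ᵥ p₀) p₀ p
    rw [vadd_vsub, one_smul, one_smul] at h
    exact h

end NCGauge

end

theorem mainTheorem1 {d n : ℕ} (hn : 0 < n)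
    {M : Type*} [TopologicalSpace M] [ChartedSpace (EuclideanSpace ℝ (Fin d)) M]
    [IsManifold (𝓡 d) ∞ M] [T2Space M] [ParacompactSpace M]
    {F : Type*} [NormedAddCommGroup F] [NormedSpace ℂ F] [FiniteDimensional ℂ F]
    (hF : Module.finrank ℂ F = n)
    {V : M → Type*} [TopologicalSpace (TotalSpace F V)]
    [∀ x, NormedAddCommGroup (V x)] [∀ x, InnerProductSpace ℂ (V x)]
    [FiberBundle F V] [VectorBundle ℂ F V] [VectorBundle ℝ F V]
    [ContMDiffVectorBundle ∞ F V (𝓡 d)]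
    (σ : NCGauge.SUStructure d F V n) :
    (∀ cov : NCGauge.suConnections σ, ∃! α : NCGauge.NCForm (NCGauge.EndAlg d F V),
      (∀ D x, NCGauge.tr (α D) x = 0) ∧ NCGauge.IsFormOf cov.1 α) ∧
    ∃ (_ : Nonempty (NCGauge.suConnections σ)) (_ : Nonempty (NCGauge.gaugeForms d F V)),
      ∃ Φ : NCGauge.suConnections σ ≃ᵃ[ℝ] NCGauge.gaugeForms d F V,
        ∀ cov : NCGauge.suConnections σ, NCGauge.IsFormOf cov.1 (Φ cov).1 := by
  have : NeZero n := ⟨hn.ne'⟩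
  have : Fact (Module.finrank ℂ F = n) := ⟨hF⟩
  have hSU : ∀ cov : NCGauge.suConnections σ, NCGauge.IsSUConnection σ cov.1 := fun cov ↦ cov.2
  have hc : ∀ cov : NCGauge.suConnections σ, NCGauge.IsConnection cov.1 :=
    fun cov ↦ (hSU cov).toIsConnection
  let f : NCGauge.suConnections σ → NCGauge.gaugeForms d F V := fun cov ↦
    ⟨NCGauge.connForm σ (hc cov), (hSU cov).connForm_mem⟩
  have huniq : ∀ (cov : NCGauge.suConnections σ) (α : NCGauge.NCForm (NCGauge.EndAlg d F V)),
      α ∈ NCGauge.gaugeForms d F V → NCGauge.IsFormOf cov.1 α → α = (f cov).1 :=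
    fun cov α h1 h2 ↦ NCGauge.eq_connForm σ (hc cov) h1.1 h2
  refine ⟨fun cov ↦ ⟨(f cov).1, ⟨(f cov).2.1, NCGauge.isFormOf_connForm σ (hc cov)⟩,
    fun α hα ↦ NCGauge.eq_connForm σ (hc cov) hα.1 hα.2⟩, ?_⟩
  obtain ⟨cov₀, h₀⟩ := NCGauge.exists_isSUConnection σ
  -- An affine subspace is a torsor only when it is nonempty, so this precedes any statement about
  -- affine maps.
  have i1 : Nonempty (NCGauge.suConnections σ) := ⟨⟨cov₀, h₀⟩⟩
  have i2 : Nonempty (NCGauge.gaugeForms d F V) := ⟨f ⟨cov₀, h₀⟩⟩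
  refine ⟨i1, i2, ?_⟩
  -- The combination of the forms is a form of the combined connection, hence its form by
  -- uniqueness.
  obtain ⟨g, hg⟩ := NCGauge.exists_affineMap_of_combination f fun c p q r ↦ Subtype.ext
    (huniq _ _ ((c • (f p -ᵥ f q) +ᵥ f r : NCGauge.gaugeForms d F V).2)
      (NCGauge.isFormOf_affine (hc p) (hc q) (hc r) σ c)).symm
  have hbij : Function.Bijective g := by
    rw [hg]
    refine ⟨fun p q h ↦ Subtype.ext ?_, fun α ↦ ?_⟩
    · exact (hSU p).eq_of_connForm_eq (hSU q) (congrArg Subtype.val h)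
    · refine ⟨⟨_, NCGauge.isSUConnection_addForm h₀ α.2⟩, Subtype.ext ?_⟩
      exact (huniq _ _ α.2 (NCGauge.isFormOf_addForm h₀ α.2)).symm
  refine ⟨AffineEquiv.ofBijective hbij, fun cov ↦ ?_⟩
  rw [AffineEquiv.ofBijective_apply, hg]
  exact NCGauge.isFormOf_connForm σ (hc cov)
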